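/- Let $\nu>0$ and $a\ge 0$. For $M\in\mathbb N$ and modes $(\ell,m)$, $\ell\ge 0$, $-\ell\le m\le\ell$, put $$c^M_{\ell,m}=\frac{\mathbb 1_{\{\ell\le M\}}}{(\ell+1)^{a}},\qquad \alpha^M_{\ell,m}=\frac{\sqrt{2\nu}}{\|c^M\|_{\ell^2}}\,c^M_{\ell,m},$$ where all norms of sequences are taken over all modes. (1) For every $M$: $\|\alpha^M\|_{\ell^2}^2=2\nu$ and $\|\alpha^M\|_{\ell^\infty}=\sqrt{2\nu}\,\|c^M\|_{\ell^2}^{-1}$. (2) As $M\to\infty$: $\|c^M\|_{\ell^2}\sim (M+1)^{1-a}/\sqrt{1-a}$ if $0\le a<1$; $\|c^M\|_{\ell^2}\sim\sqrt{2\log(M+1)}$ if $a=1$; and $\|c^M\|_{\ell^2}\to\big(\sum_{\ell\ge0}(2\ell+1)(\ell+1)^{-2a}\big)^{1/2}<\infty$ if $a>1$. Here $\sim$ means that the quotient tends to $1$. (3) $\|\alpha^M\|_{\ell^\infty}\to0$ as $M\to\infty$ if and only if $a\le 1$. (4) Let $Y_{\ell,m}$ be a complete $L^2(\mathbb S^2)$-orthogonal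 system of real spherical harmonics: for each $\ell$, the $2\ell+1$ functions $Y_{\ell,m}$ are nonzero restrictions to $\mathbb S^2$ of homogeneous harmonic polynomials of degree $\ell$. Suppose that they are normalised, for $\ell\ge1$, so that $\|\nabla^\perp Y_{\ell,m}\|_{L^2}=1$ (that is, the noise fields $\nabla^\perp Y_{\ell,m}$ are $L^2$-orthonormal); if $a\ge1$, the normalisation $\|Y_{\ell,m}\|_{L^2}=1$ for $\ell\ge 1$ is allowed as well. Let $\nabla$ be the surface gradient, $\nabla^\perp$ its rotation by 90 degrees in the tangent plane, and $\langle\cdot,\cdot\rangle$ the $L^2(\mathbb S^2)$ pairing. On a filtered probability space let $(B^{\ell,m})$ be independent Brownian motions relative to the filtration, and for each $M$ let $\omega^M$ be a progressively measurable $L^2(\mathbb S^2)$-valued process with $\mathbb E\int_0^T\|\omega^M_s\|_{L^2}^2\,ds<\infty$. For $\phi\in C^\infty(\mathbb S^2)$ and $0\le t\le T$ let $$\mathcal M^M_t=\mathbb E\Big|\sum_{\ell=0}^M\sum_{m=-\ell}^{\ell}\int_0^t\big\langle\alpha^M_{\ell,m}\nabla^\perp Y_{\ell,m}\cdot\nabla\phi,\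 \omega^M_s\big\rangle\,dB^{\ell,m}_s\Big|^2$$ with Itô integrals. Then: (a) the Itô integrals exist as $L^2$-limits of integrals of simple processes, and for all $M$, $\phi$ and $t\le T$, $$\mathcal M^M_t\le\|\alpha^M\|_{\ell^\infty}^2\,\|\nabla\phi\|_\infty^2\ \mathbb E\int_0^T\|\omega^M_s\|_{L^2}^2\,ds ;$$ (b) if $a\le1$ and $\sup_M\mathbb E\int_0^T\|\omega^M_s\|^2_{L^2}\,ds<\infty$, then $\mathcal M^M_t\to0$ as $M\to\infty$ for all $\phi\in C^\infty(\mathbb S^2)$ and $t\le T$; (c) $a\le1$ is necessary: let $t\le T$, and let $\omega$ be a progressively measurable $L^2(\mathbb S^2)$-valued process with $\mathbb E\int_0^T\|\omega_s\|_{L^2}^2\,ds<\infty$ which is not almost everywhere on $[0,t]\times\Omega$ constant in space, and such that for every $g\in C^\infty(\mathbb S^2)$ one has $\mathbb E\langle\omega^M_s-\omega_s,g\rangle^2\to0$ for almost every $s\in[0,t]$. If $\mathcal M^M_t\to0$ for every $\phi\in C^\infty(\mathbb S^2)$, then $a\le 1$. -/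

import Mathlib

open MeasureTheory ProbabilityTheory Filter Topology Set
open scoped NNReal ENNReal Manifold Gradient

noncomputable section

/-! ### The unit sphere, tangential gradients and the Poisson bracket -/

/-- Euclidean space `ℝ³`. -/
abbrev R3 : Type := EuclideanSpace ℝ (Fin 3)

/-- The unit sphere of `ℝ³`. -/
abbrev S2 : Type := Metric.sphere (0 : R3) 1

/-- The dimension count through which Mathlib puts the smooth structure on `S2`. -/
instance factFinrankR3 : Fact (Module.finrank ℝ R3 = 2 + 1) := ⟨by simp⟩

/-- The surface measure of the sphere (of total mass `4π`). -/
def surf : Measure S2 := (volume : Measure R3).toSphere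

/-- Real-valued smooth functions on the sphere. -/
def SmoothOnSphere (f : S2 → ℝ) : Prop := ContMDiff (𝓡 2) 𝓘(ℝ, ℝ) ((⊤ : ℕ∞) : WithTop ℕ∞) f

/-- The extension `x ↦ f (x / ‖x‖)` of `f : S2 → ℝ`, which is constant along rays
(with the irrelevant value `0` at the origin). -/
def radialExt (f : S2 → ℝ) (x : R3) : ℝ :=
  if h : x = 0 then 0 else
    f ⟨‖x‖⁻¹ • x, by
      rw [mem_sphere_zero_iff_norm, norm_smul, norm_inv, norm_norm]
      exact inv_mul_cancel₀ (norm_ne_zero_iff.mpr h)⟩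

/-- The surface gradient `∇f(x)`, a vector of `ℝ³` tangent to the sphere at `x`: the gradient
of the extension of `f` that is constant along rays. -/
def sphereGrad (f : S2 → ℝ) (x : S2) : R3 := ∇ (radialExt f) (x : R3)

/-- The vector product of `ℝ³`. -/
def cross3 (u v : R3) : R3 := WithLp.toLp 2 (crossProduct u.ofLp v.ofLp)

/-- The skew gradient `∇^⊥ f`: the surface gradient rotated by 90 degrees in the tangent plane. -/
def skewGrad (f : S2 → ℝ) (x : S2) : R3 := cross3 (x : R3) (sphereGrad f x)

/-- The Poisson bracket `{f, g} = ∇^⊥ f · ∇ g`. -/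
def bracket (f g : S2 → ℝ) (x : S2) : ℝ := inner ℝ (skewGrad f x) (sphereGrad g x)

/-- `‖∇f‖_∞`. -/
def gradSup (f : S2 → ℝ) : ℝ := ⨆ x : S2, ‖sphereGrad f x‖

/-- The space `L²(S²)` of real functions. -/
abbrev L2S : Type := Lp ℝ 2 surf

/-- The pairing `⟨f, u⟩ = ∫_{S²} f u` of a function with an element of `L²(S²)`. -/
def pair (f : S2 → ℝ) (u : L2S) : ℝ := ∫ x, f x * u x ∂surf

/-! ### Spherical harmonics -/

/-- The modes `(ℓ, m)` with `ℓ = 0, 1, 2, …` and `m = -ℓ, …, ℓ`. -/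
abbrev Mode : Type := Σ l : ℕ, Finset.Icc (-(l : ℤ)) (l : ℤ)

/-- A spherical harmonic of degree `l`: the restriction to the sphere of a homogeneous harmonic
polynomial of degree `l` in three variables. -/
def IsSphericalHarmonic (l : ℕ) (f : S2 → ℝ) : Prop :=
  ∃ p : MvPolynomial (Fin 3) ℝ, p.IsHomogeneous l ∧
    ∑ i : Fin 3, MvPolynomial.pderiv i (MvPolynomial.pderiv i p) = 0 ∧
    ∀ x : S2, f x = MvPolynomial.eval (x : R3).ofLp p

/-- A complete system `Y_{ℓ,m}` of real spherical harmonics, up to normalisation: for each degree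
`ℓ` the `2ℓ+1` functions `Y_{ℓ,m}` are nonzero spherical harmonics of degree `ℓ`, and all of them
are pairwise orthogonal in `L²(S²)`. -/
structure IsHarmonicSystem (Y : Mode → S2 → ℝ) : Prop where
  harmonic : ∀ i : Mode, IsSphericalHarmonic i.1 (Y i)
  ne_zero : ∀ i : Mode, Y i ≠ 0
  orthogonal : ∀ i j : Mode, i ≠ j → ∫ x, Y i x * Y j x ∂surf = 0

/-! ### The noise coefficients -/

/-- `c^M_{ℓ,m} = (ℓ+1)^{-a}` for `0 ≤ ℓ ≤ M`, and `0` for `ℓ > M`. -/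
def noiseC (a : ℝ) (M : ℕ) (i : Mode) : ℝ :=
  if i.1 ≤ M then 1 / ((i.1 : ℝ) + 1) ^ a else 0

/-- The `ℓ²` norm of a family indexed by the modes. -/
def normTwo (x : Mode → ℝ) : ℝ := √(∑' i, x i ^ 2)

/-- The `ℓ^∞` norm of a family indexed by the modes. -/
def normSup (x : Mode → ℝ) : ℝ := ⨆ i, |x i|

/-- `α^M_{ℓ,m} = √(2ν) c^M_{ℓ,m} / ‖c^M‖_{ℓ²}`. -/
def noiseAlpha (ν a : ℝ) (M : ℕ) (i : Mode) : ℝ :=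
  √(2 * ν) / normTwo (noiseC a M) * noiseC a M i

/-! ### Brownian motions and the Itô integral -/

/-- Lebesgue measure on the time axis `[0, ∞)`. -/
def timeMeas : Measure ℝ≥0 := (volume : Measure ℝ).comap NNReal.toReal

theorem timeMeas_Iic (t : ℝ≥0) : timeMeas (Iic t) = t := by
  have h : MeasurableEmbedding NNReal.toReal :=
    MeasurableEmbedding.subtype_coe measurableSet_Ici
  have e : NNReal.toReal '' Iic t = Icc (0 : ℝ) t := by
    ext x
    constructor
    · rintro ⟨y, hy, rfl⟩
      exact ⟨y.2, NNReal.coe_le_coe.mpr hy⟩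
    · rintro ⟨h0, h1⟩
      exact ⟨⟨x, h0⟩, h1, rfl⟩
  rw [timeMeas, h.comap_apply, e, Real.volume_Icc, sub_zero, ENNReal.ofReal_coe_nnreal]

section Ito

variable {Ω : Type*} {mΩ : MeasurableSpace Ω}

/-- A family of independent real Brownian motions relative to the filtration `𝓕`. -/
structure IsBrownianFamily {ι : Type*} (𝓕 : Filtration ℝ≥0 mΩ) (P : Measure Ω)
    (B : ι → ℝ≥0 → Ω → ℝ) : Prop where
  brownian : ∀ i, IsBrownianReal (B i) P
  adapted : ∀ i, StronglyAdapted 𝓕 (B i)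
  indep : iIndepFun (fun i (θ : Ω) (t : ℝ≥0) => B i t θ) P
  indep_incr : ∀ s t : ℝ≥0, s ≤ t →
    Indep (MeasurableSpace.comap (fun (θ : Ω) (i : ι) => B i t θ - B i s θ) inferInstance) (𝓕 s) P

/-- A simple process `∑_{k < n} ξ_k 1_{(τ_k, τ_{k+1}]}` with deterministic times
`τ_0 ≤ τ_1 ≤ …` and square integrable, `𝓕_{τ_k}`-measurable `ξ_k`. -/
structure SimpleProc (𝓕 : Filtration ℝ≥0 mΩ) (P : Measure Ω) where
  n : ℕ
  τ : ℕ → ℝ≥0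
  mono : Monotone τ
  ξ : ℕ → Ω → ℝ
  meas : ∀ k, StronglyMeasurable[𝓕 (τ k)] (ξ k)
  memLp : ∀ k, MemLp (ξ k) 2 P

/-- The value of a simple process at time `s`. -/
def SimpleProc.val {𝓕 : Filtration ℝ≥0 mΩ} {P : Measure Ω} (S : SimpleProc 𝓕 P)
    (s : ℝ≥0) (θ : Ω) : ℝ :=
  ∑ k ∈ Finset.range S.n, (Ioc (S.τ k) (S.τ (k + 1))).indicator (fun _ => S.ξ k θ) s

/-- The elementary stochastic integral `∫_0^t S dW = ∑_k ξ_k (W_{τ_{k+1} ∧ t} - W_{τ_k ∧ t})`. -/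
def SimpleProc.integral {𝓕 : Filtration ℝ≥0 mΩ} {P : Measure Ω} (S : SimpleProc 𝓕 P)
    (W : ℝ≥0 → Ω → ℝ) (t : ℝ≥0) (θ : Ω) : ℝ :=
  ∑ k ∈ Finset.range S.n, S.ξ k θ * (W (min (S.τ (k + 1)) t) θ - W (min (S.τ k) t) θ)

/-- `I` is (a version of) the Itô integral `∫_0^t H dW`: it is the `L²(P)`-limit of the elementary
integrals of simple processes which converge to `H` in `L²([0,t] × Ω)`. -/
def IsItoIntegral (𝓕 : Filtration ℝ≥0 mΩ) (P : Measure Ω) (W : ℝ≥0 → Ω → ℝ)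
    (H : ℝ≥0 → Ω → ℝ) (t : ℝ≥0) (I : Ω → ℝ) : Prop :=
  MemLp I 2 P ∧ ∃ S : ℕ → SimpleProc 𝓕 P,
    Tendsto (fun n => eLpNorm (fun z : ℝ≥0 × Ω => (S n).val z.1 z.2 - H z.1 z.2) 2
      ((timeMeas.restrict (Iic t)).prod P)) atTop (𝓝 0) ∧
    Tendsto (fun n => eLpNorm (fun θ => (S n).integral W t θ - I θ) 2 P) atTop (𝓝 0)

open Classical in
/-- The Itô integral `∫_0^t H dW` (with value `0` if it does not exist). -/
def itoIntegral (𝓕 : Filtration ℝ≥0 mΩ) (P : Measure Ω) (W : ℝ≥0 → Ω → ℝ)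
    (H : ℝ≥0 → Ω → ℝ) (t : ℝ≥0) : Ω → ℝ :=
  if h : ∃ I, IsItoIntegral 𝓕 P W H t I then h.choose else 0

/-! ### The martingale term -/

/-- The integrand `⟨α^M_{ℓ,m} ∇^⊥ Y_{ℓ,m} · ∇φ, ω_s⟩` of the mode `i = (ℓ, m)`. -/
def noiseIntegrand (ν a : ℝ) (M : ℕ) (Y : Mode → S2 → ℝ) (φ : S2 → ℝ) (ω : ℝ≥0 → Ω → L2S)
    (i : Mode) (s : ℝ≥0) (θ : Ω) : ℝ :=
  pair (fun x => noiseAlpha ν a M i * bracket (Y i) φ x) (ω s θ)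

/-- The martingale term
`𝓜^M_t = E |∑_{ℓ ≤ M} ∑_{|m| ≤ ℓ} ∫_0^t ⟨α^M_{ℓ,m} ∇^⊥ Y_{ℓ,m} · ∇φ, ω_s⟩ dB^{ℓ,m}_s|²`. -/
def martingaleTerm (𝓕 : Filtration ℝ≥0 mΩ) (P : Measure Ω) (B : Mode → ℝ≥0 → Ω → ℝ)
    (ν a : ℝ) (M : ℕ) (Y : Mode → S2 → ℝ) (φ : S2 → ℝ) (ω : ℝ≥0 → Ω → L2S) (t : ℝ≥0) : ℝ :=
  ∫ θ, |∑ l ∈ Finset.range (M + 1), ∑ m : Finset.Icc (-(l : ℤ)) (l : ℤ),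
    itoIntegral 𝓕 P (B ⟨l, m⟩) (noiseIntegrand ν a M Y φ ω ⟨l, m⟩) t θ| ^ 2 ∂P

/-- A progressively measurable process with values in `L²(S²)` and
`E ∫_0^T ‖ω_s‖²_{L²} ds < ∞`. -/
structure IsL2Process (𝓕 : Filtration ℝ≥0 mΩ) (P : Measure Ω) (T : ℝ≥0)
    (ω : ℝ≥0 → Ω → L2S) : Prop where
  prog : IsStronglyProgressive 𝓕 ω
  memLp : MemLp (fun z : ℝ≥0 × Ω => ω z.1 z.2) 2 ((timeMeas.restrict (Iic T)).prod P)

/-- `E ∫_0^T ‖ω_s‖²_{L²} ds`. -/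
def meanEnstrophy (P : Measure Ω) (T : ℝ≥0) (ω : ℝ≥0 → Ω → L2S) : ℝ :=
  ∫ θ, (∫ s in Iic T, ‖ω s θ‖ ^ 2 ∂timeMeas) ∂P

/-- Weak convergence in mean square of `ω^M` to `ω'` on `[0, t]`: for every smooth `g` and almost
every `s ∈ [0, t]`, `E ⟨ω^M_s - ω'_s, g⟩² → 0`. -/
def WeakMeanSquareConv (P : Measure Ω) (t : ℝ≥0) (ω : ℕ → ℝ≥0 → Ω → L2S)
    (ω' : ℝ≥0 → Ω → L2S) : Prop :=
  ∀ g : S2 → ℝ, SmoothOnSphere g → ∀ᵐ s ∂(timeMeas.restrict (Iic t)),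
    Tendsto (fun M => ∫⁻ θ, ‖pair g (ω M s θ - ω' s θ)‖ₑ ^ 2 ∂P) atTop (𝓝 0)

/-- For almost every `(s, θ) ∈ [0, t] × Ω` the function `ω'_s(θ)` is a.e. constant on the sphere. -/
def SpatiallyConstant (P : Measure Ω) (t : ℝ≥0) (ω' : ℝ≥0 → Ω → L2S) : Prop :=
  ∀ᵐ z ∂((timeMeas.restrict (Iic t)).prod P), ∃ k : ℝ, ∀ᵐ x ∂surf, ω' z.1 z.2 x = k

end Ito

end

/-!
The norms of `c^M` are governed by the partial sums of `(2l+1) / (l+1)^{2a}`. For `a < 1` and `a = 1`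
the summands are asymptotic to telescoping differences with divergent sums
(`isEquivalent_sum_range`), for `a > 1` the series converges. Since `‖c^M‖_{ℓ^∞} = 1`, this also
decides whether `‖α^M‖_{ℓ^∞} = √(2ν) / ‖c^M‖_{ℓ²}` tends to zero.

*Itô integrals.* A progressively measurable `H` in `L²([0,t] × Ω)` is approximated by the simple
processes which take on each interval of a uniform grid the average of `H` over the preceding
interval: looking only at the past keeps them adapted, averaging is a contraction of `L²`, and for
bounded continuous paths the convergence is pointwise (`tendsto_eLpNorm_gridProc`). With the Itô
isometry for simple processes (`SimpleProc.integral_mul_integral`) this gives existence. Integrals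
against different Brownian motions of the family are orthogonal, so the martingale term equals
`∑ E ∫_0^t ⟨α ∇^⊥ Y · ∇φ, ω_s⟩² ds` (`martingaleTerm_eq`).

*The upper bound.* Integrating `∂_i (q e^{-|x|²})` over `ℝ³` in polar coordinates yields
`∫ ∂_i q = (d+2) ∫ x_i q` on the sphere for homogeneous `q` of degree `d` (`integral_pderiv`), and
with it `∫ Δh = n(n+1) ∫ h` for homogeneous `h` of degree `n` (`integral_polyLaplacian`). Applied to
products of harmonic polynomials this is Green's formula (`integral_inner_skewGrad`): the fields
`∇^⊥ Y` are orthogonal, with `‖∇^⊥ Y‖² = l(l+1) ‖Y‖²`. Under either normalisation the fields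
`α ∇^⊥ Y` have norm at most `‖α‖_{ℓ^∞}`, so the sum above is bounded by Bessel's inequality for the
field `ω_s ∇φ` (`sum_sq_pair_bracket_le`).

*Necessity of `a ≤ 1`.* If `a > 1`, each coefficient `α^M_{l,m}` has a positive limit, so when the
martingale terms vanish in the limit, the pairing of `ω^M` with each `{Y_{l,m}, φ}` tends to zero in
mean square. By Fatou's lemma the limit process is orthogonal to all `{Y_{l,m}, φ}`
(`ae_pair_bracket_eq_zero`). For `l = 1` the `Y_{1,m}` are three independent linear forms, and their
brackets with polynomials span the derivatives along rotations (`polyPair_angMom_eq_zero`). As the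
squares of these derivatives add up to the Laplace–Beltrami operator, the functional `p ↦ ⟨p, u⟩`
satisfies the recursion `⟨Δp, u⟩ = n(n+1) ⟨p, u⟩`, which determines it up to a factor and which the
surface integral satisfies as well. Since polynomials are dense in `L²`, `u` is constant
(`ae_const_of_polyPair_angMom`).
-/

/-! ### The noise coefficients -/

/-- The square of `‖c^M‖_{ℓ²}`, summed degree by degree. -/
noncomputable def coeffSum (a : ℝ) (M : ℕ) : ℝ :=
  ∑ l ∈ Finset.range (M + 1), (2 * (l : ℝ) + 1) / ((l : ℝ) + 1) ^ (2 * a)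

lemma tsum_noiseC_sq (a : ℝ) (M : ℕ) : ∑' i, noiseC a M i ^ 2 = coeffSum a M := by
  rw [tsum_eq_sum (s := (Finset.range (M + 1)).sigma fun l => Finset.univ)]
  · rw [Finset.sum_sigma, coeffSum]
    refine Finset.sum_congr rfl fun l hl => ?_
    have hlM : l ≤ M := Nat.lt_succ_iff.mp (Finset.mem_range.mp hl)
    have hl0 : (0 : ℝ) ≤ (l : ℝ) + 1 := by positivity
    simp only [noiseC, hlM, if_true, Finset.sum_const, nsmul_eq_mul]
    rw [Finset.card_univ, Fintype.card_coe, Int.card_Icc, div_pow, one_pow,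
      ← Real.rpow_mul_natCast hl0]
    have : ((l : ℤ) + 1 - -(l : ℤ)).toNat = 2 * l + 1 := by omega
    rw [this]
    push_cast
    rw [mul_comm a 2]
    ring
  · intro i hi
    have : ¬ i.1 ≤ M := by
      simpa [Nat.lt_succ_iff] using hi
    simp [noiseC, this]

lemma normTwo_noiseC (a : ℝ) (M : ℕ) : normTwo (noiseC a M) = √(coeffSum a M) := by
  rw [normTwo, tsum_noiseC_sq]

lemma one_le_coeffSum (a : ℝ) (M : ℕ) : 1 ≤ coeffSum a M := by
  have := Finset.single_le_sum (f := fun l : ℕ => (2 * (l : ℝ) + 1) / ((l : ℝ) + 1) ^ (2 * a))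
    (fun l _ => by positivity) (Finset.mem_range.mpr (Nat.succ_pos M))
  simpa [coeffSum] using this

lemma normTwo_noiseC_pos (a : ℝ) (M : ℕ) : 0 < normTwo (noiseC a M) := by
  rw [normTwo_noiseC]
  exact Real.sqrt_pos.mpr (one_pos.trans_le (one_le_coeffSum a M))

lemma normTwo_noiseAlpha_sq {ν : ℝ} (hν : 0 < ν) (a : ℝ) (M : ℕ) :
    normTwo (noiseAlpha ν a M) ^ 2 = 2 * ν := by
  have h0 := normTwo_noiseC_pos a M
  have h1 : ∑' i, noiseAlpha ν a M i ^ 2 = 2 * ν := by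
    simp only [noiseAlpha, mul_pow, tsum_mul_left]
    rw [tsum_noiseC_sq, div_pow, Real.sq_sqrt (by positivity), normTwo_noiseC,
      Real.sq_sqrt (zero_le_one.trans (one_le_coeffSum a M))]
    field_simp [(one_pos.trans_le (one_le_coeffSum a M)).ne']
  rw [normTwo, h1, Real.sq_sqrt (by positivity)]

lemma noiseC_nonneg (a : ℝ) (M : ℕ) (i : Mode) : 0 ≤ noiseC a M i := by
  unfold noiseC
  split_ifs <;> positivity

lemma noiseC_le_one {a : ℝ} (ha : 0 ≤ a) (M : ℕ) (i : Mode) : noiseC a M i ≤ 1 := by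
  unfold noiseC
  split_ifs
  · rw [div_le_one (by positivity)]
    exact Real.one_le_rpow (by simp) ha
  · exact zero_le_one

lemma normSup_noiseAlpha (ν : ℝ) {a : ℝ} (ha : 0 ≤ a) (M : ℕ) :
    normSup (noiseAlpha ν a M) = √(2 * ν) * (normTwo (noiseC a M))⁻¹ := by
  have h0 := normTwo_noiseC_pos a M
  have hle : ∀ i, |noiseAlpha ν a M i| ≤ √(2 * ν) * (normTwo (noiseC a M))⁻¹ := by
    intro i
    rw [noiseAlpha, abs_mul, abs_of_nonneg (noiseC_nonneg a M i), abs_of_nonneg (by positivity),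
      div_eq_mul_inv]
    exact mul_le_of_le_one_right (by positivity) (noiseC_le_one ha M i)
  have : Nonempty Mode := ⟨⟨0, 0, by simp⟩⟩
  refine le_antisymm (ciSup_le hle) ?_
  refine le_ciSup_of_le ⟨_, by rintro _ ⟨i, rfl⟩; exact hle i⟩ ⟨0, 0, by simp⟩ ?_
  rw [noiseAlpha, abs_of_nonneg (mul_nonneg (by positivity) (noiseC_nonneg _ _ _)), div_eq_mul_inv]
  simp [noiseC]

/-- Equivalent sequences with divergent sums have equivalent partial sums. -/
lemma isEquivalent_sum_range {f g : ℕ → ℝ} (h : Asymptotics.IsEquivalent atTop f g) (hg : 0 ≤ g)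
    (hs : Tendsto (fun n => ∑ i ∈ Finset.range n, g i) atTop atTop) :
    Asymptotics.IsEquivalent atTop (fun n => ∑ i ∈ Finset.range n, f i)
      (fun n => ∑ i ∈ Finset.range n, g i) := by
  have := Asymptotics.IsLittleO.sum_range h.isLittleO hg hs
  refine this.congr_left fun n => ?_
  simp [Finset.sum_sub_distrib]

/-- The summands of `‖c^M‖²` are, up to the factor `(k+1)^{2-2a}`, equal to `x (2 - x)` with
`x = 1 / (k+1)`; to first order so is every `F x` with `F 0 = 0` and `F' 0 = 2`. -/
lemma isEquivalent_one_div_of_hasDerivAt {F : ℝ → ℝ} (hF : HasDerivAt F 2 0) (h0 : F 0 = 0) :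
    Asymptotics.IsEquivalent atTop (fun k : ℕ => 1 / ((k : ℝ) + 1) * (2 - 1 / ((k : ℝ) + 1)))
      (fun k : ℕ => F (1 / ((k : ℝ) + 1))) := by
  have key : ∀ G : ℝ → ℝ, HasDerivAt G 2 0 → G 0 = 0 →
      Asymptotics.IsEquivalent (𝓝 0) G (fun x => 2 * x) := by
    intro G hG hG0
    have := hG.isLittleO
    simp only [hG0, sub_zero, smul_eq_mul] at this
    have h2 : (fun x : ℝ => x) =O[𝓝 0] fun x => 2 * x :=
      Asymptotics.IsBigO.of_bound 1 (by
        filter_upwards with x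
        rw [norm_mul]
        norm_num
        linarith [abs_nonneg x])
    refine (this.trans_isBigO h2).congr_left fun x => ?_
    simp [mul_comm]
  have hQ : HasDerivAt (fun x : ℝ => x * (2 - x)) 2 0 := by
    have := (hasDerivAt_id' (0 : ℝ)).fun_mul ((hasDerivAt_id' (0 : ℝ)).const_sub 2)
    exact this.congr_deriv (by norm_num)
  have h := (key _ hQ (by simp)).trans (key F hF h0).symm
  exact h.comp_tendsto tendsto_one_div_add_atTop_nhds_zero_nat

lemma isEquivalent_sqrt {f g : ℕ → ℝ} (h : Asymptotics.IsEquivalent atTop f g)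
    (hg : ∀ᶠ n in atTop, 0 < g n) :
    Asymptotics.IsEquivalent atTop (fun n => √(f n)) (fun n => √(g n)) := by
  have h1 := (Asymptotics.isEquivalent_iff_tendsto_one (hg.mono fun n hn => hn.ne')).mp h
  refine (Asymptotics.isEquivalent_iff_tendsto_one
    (hg.mono fun n hn => (Real.sqrt_pos.mpr hn).ne')).mpr ?_
  have h2 := (Real.continuous_sqrt.tendsto 1).comp h1
  rw [Real.sqrt_one] at h2
  refine h2.congr' (hg.mono fun n hn => ?_)
  simp [Real.sqrt_div' _ hn.le]

lemma coeff_eq (a : ℝ) (k : ℕ) :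
    (2 * (k : ℝ) + 1) / ((k : ℝ) + 1) ^ (2 * a) =
      ((k : ℝ) + 1) ^ (2 - 2 * a) * (1 / ((k : ℝ) + 1) * (2 - 1 / ((k : ℝ) + 1))) := by
  have hk : (0 : ℝ) < (k : ℝ) + 1 := by positivity
  rw [Real.rpow_sub hk, Real.rpow_two]
  field_simp
  ring

lemma isEquivalent_normTwo_of_lt_one {a : ℝ} (h : a < 1) :
    Asymptotics.IsEquivalent atTop (fun M : ℕ => normTwo (noiseC a M))
      (fun M : ℕ => ((M : ℝ) + 1) ^ (1 - a) / √(1 - a)) := by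
  have hs : 0 < 2 - 2 * a := by linarith
  set s := 2 - 2 * a with hsdef
  have ha' : 0 < 1 - a := by linarith
  -- with this `F` the products `(k+1)^s F (1/(k+1))` telescope
  have hF : HasDerivAt (fun x : ℝ => (1 - (1 - x) ^ s) / (1 - a)) 2 0 := by
    have h1 : HasDerivAt (fun x : ℝ => (1 - x) ^ s) (-1 * s * (1 - 0) ^ (s - 1)) 0 :=
      HasDerivAt.rpow_const ((hasDerivAt_id (0 : ℝ)).const_sub 1) (by norm_num)
    have h2 := (h1.const_sub 1).div_const (1 - a)
    refine h2.congr_deriv ?_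
    rw [sub_zero, Real.one_rpow, div_eq_iff ha'.ne', hsdef]
    ring
  have hE := isEquivalent_one_div_of_hasDerivAt hF (by simp)
  set g : ℕ → ℝ := fun k => (((k + 1 : ℕ) : ℝ) ^ s - (k : ℝ) ^ s) / (1 - a) with hg
  have hg0 : 0 ≤ g := fun k => by
    refine div_nonneg (sub_nonneg.mpr ?_) ha'.le
    exact Real.rpow_le_rpow (by positivity) (by push_cast; linarith) hs.le
  have hsum : ∀ n : ℕ, ∑ i ∈ Finset.range n, g i = (n : ℝ) ^ s / (1 - a) := by
    intro n
    rw [hg, ← Finset.sum_div, Finset.sum_range_sub (fun k : ℕ => (k : ℝ) ^ s)]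
    simp [Real.zero_rpow hs.ne']
  have hfg : Asymptotics.IsEquivalent atTop
      (fun k : ℕ => (2 * (k : ℝ) + 1) / ((k : ℝ) + 1) ^ (2 * a)) g := by
    have := (Asymptotics.IsEquivalent.refl
      (u := fun k : ℕ => ((k : ℝ) + 1) ^ s) (l := atTop)).mul hE
    refine (this.congr_left (Eventually.of_forall fun k => ?_)).congr_right
      (Eventually.of_forall fun k => ?_)
    · exact (coeff_eq a k).symm
    · have hk : (0 : ℝ) < (k : ℝ) + 1 := by positivity
      have e : (k : ℝ) = ((k : ℝ) + 1) * (1 - 1 / ((k : ℝ) + 1)) := by field_simp; ring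
      have e2 : (k : ℝ) ^ s = ((k : ℝ) + 1) ^ s * (1 - 1 / ((k : ℝ) + 1)) ^ s := by
        conv_lhs => rw [e]
        refine Real.mul_rpow hk.le ?_
        rw [sub_nonneg, div_le_one hk]
        linarith [(Nat.cast_nonneg k : (0 : ℝ) ≤ k)]
      simp only [hg, Pi.mul_apply, e2]
      push_cast
      ring
  have hT : Tendsto (fun n : ℕ => (n : ℝ) ^ s / (1 - a)) atTop atTop :=
    ((tendsto_rpow_atTop hs).comp tendsto_natCast_atTop_atTop).atTop_div_const ha'
  have hS := isEquivalent_sum_range hfg hg0 (by simpa only [hsum] using hT)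
  have hS' := hS.comp_tendsto (tendsto_add_atTop_nat 1)
  have hS2 := isEquivalent_sqrt hS' (Eventually.of_forall fun n => by
    simp only [Function.comp, hsum]; positivity)
  refine (hS2.congr_left (Eventually.of_forall fun n => ?_)).congr_right
    (Eventually.of_forall fun n => ?_)
  · simp only [normTwo_noiseC, coeffSum, Function.comp]
  · simp only [Function.comp, hsum]
    rw [Real.sqrt_div' _ ha'.le]
    congr 1
    have : s = (1 - a) * (2 : ℕ) := by rw [hsdef]; push_cast; ring
    rw [this, Real.rpow_mul_natCast (by positivity), Real.sqrt_sq (by positivity)]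
    push_cast
    rfl

lemma isEquivalent_normTwo_one :
    Asymptotics.IsEquivalent atTop (fun M : ℕ => normTwo (noiseC 1 M))
      (fun M : ℕ => √(2 * Real.log ((M : ℝ) + 1))) := by
  -- for `k > 0`, `F (1/(k+1)) = 2 log (k+1) - 2 log k` telescopes
  have hF : HasDerivAt (fun x : ℝ => -(2 * Real.log (1 - x))) 2 0 := by
    have h1 := (((hasDerivAt_id' (0 : ℝ)).const_sub 1).log (by norm_num)).const_mul 2
    exact h1.fun_neg.congr_deriv (by norm_num)
  have hE := isEquivalent_one_div_of_hasDerivAt hF (by simp)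
  set g : ℕ → ℝ := fun k => 2 * (Real.log ((k + 1 : ℕ) : ℝ) - Real.log (k : ℝ)) with hg
  have hg0 : 0 ≤ g := fun k => by
    refine mul_nonneg zero_le_two (sub_nonneg.mpr ?_)
    rcases Nat.eq_zero_or_pos k with rfl | hk
    · simp
    · exact Real.log_le_log (by exact_mod_cast hk) (by push_cast; linarith)
  have hsum : ∀ n : ℕ, ∑ i ∈ Finset.range n, g i = 2 * Real.log n := by
    intro n
    rw [hg, ← Finset.mul_sum, Finset.sum_range_sub (fun k : ℕ => Real.log (k : ℝ))]
    simp
  have hfg : Asymptotics.IsEquivalent atTop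
      (fun k : ℕ => (2 * (k : ℝ) + 1) / ((k : ℝ) + 1) ^ (2 * (1 : ℝ))) g := by
    refine (hE.congr_left (Eventually.of_forall fun k => ?_)).congr_right ?_
    · rw [coeff_eq]
      norm_num
    · filter_upwards [eventually_gt_atTop 0] with k hk
      have hk0 : (0 : ℝ) < k := by exact_mod_cast hk
      have e : 1 - 1 / ((k : ℝ) + 1) = k / (k + 1) := by field_simp; ring
      simp only [hg, e]
      rw [Real.log_div hk0.ne' (by positivity)]
      push_cast
      ring
  have hT : Tendsto (fun n : ℕ => 2 * Real.log n) atTop atTop :=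
    (Real.tendsto_log_atTop.comp tendsto_natCast_atTop_atTop).const_mul_atTop two_pos
  have hS := isEquivalent_sum_range hfg hg0 (by simpa only [hsum] using hT)
  have hS' := hS.comp_tendsto (tendsto_add_atTop_nat 1)
  have hS2 := isEquivalent_sqrt hS' (by
    filter_upwards [eventually_gt_atTop 0] with n hn
    simp only [Function.comp, hsum]
    refine mul_pos two_pos (Real.log_pos ?_)
    exact_mod_cast Nat.succ_lt_succ hn)
  refine (hS2.congr_left (Eventually.of_forall fun n => ?_)).congr_right
    (Eventually.of_forall fun n => ?_)
  · simp only [normTwo_noiseC, coeffSum, Function.comp]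
  · simp only [Function.comp, hsum]
    push_cast
    rfl

lemma summable_coeff {a : ℝ} (h : 1 < a) :
    Summable (fun l : ℕ => (2 * (l : ℝ) + 1) / ((l : ℝ) + 1) ^ (2 * a)) := by
  have h1 : Summable (fun l : ℕ => 2 * (1 / (((l + 1 : ℕ) : ℝ)) ^ (2 * a - 1))) :=
    ((summable_nat_add_iff 1).mpr
      (Real.summable_one_div_nat_rpow.mpr (by linarith : 1 < 2 * a - 1))).mul_left 2
  refine Summable.of_nonneg_of_le (fun l => by positivity) (fun l => ?_) h1
  have hl : (0 : ℝ) < (l : ℝ) + 1 := by positivity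
  push_cast
  rw [Real.rpow_sub hl, Real.rpow_one, one_div_div, ← mul_div_assoc]
  gcongr
  linarith

lemma tendsto_normTwo_of_one_lt {a : ℝ} (h : 1 < a) :
    Tendsto (fun M : ℕ => normTwo (noiseC a M)) atTop
        (𝓝 (√(∑' l : ℕ, (2 * (l : ℝ) + 1) / ((l : ℝ) + 1) ^ (2 * a)))) := by
  simp only [normTwo_noiseC]
  exact ((summable_coeff h).hasSum.tendsto_sum_nat.comp (tendsto_add_atTop_nat 1)).sqrt

lemma tendsto_normTwo_atTop {a : ℝ} (h : a ≤ 1) :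
    Tendsto (fun M : ℕ => normTwo (noiseC a M)) atTop atTop := by
  simp only [normTwo_noiseC]
  refine Real.tendsto_sqrt_atTop.comp ?_
  refine tendsto_atTop_mono (fun M => ?_)
    (Real.tendsto_sum_range_one_div_nat_succ_atTop.comp (tendsto_add_atTop_nat 1))
  refine Finset.sum_le_sum fun l _ => ?_
  have hl : (1 : ℝ) ≤ (l : ℝ) + 1 := by simp
  have h1 : ((l : ℝ) + 1) ^ (2 * a) ≤ ((l : ℝ) + 1) ^ 2 := by
    rw [← Real.rpow_two]
    exact Real.rpow_le_rpow_of_exponent_le hl (by linarith)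
  calc 1 / ((l : ℝ) + 1) = ((l : ℝ) + 1) / ((l : ℝ) + 1) ^ 2 := by field_simp
    _ ≤ (2 * (l : ℝ) + 1) / ((l : ℝ) + 1) ^ 2 := by
      gcongr
      linarith [(Nat.cast_nonneg l : (0 : ℝ) ≤ l)]
    _ ≤ _ := by gcongr

lemma tendsto_normSup_noiseAlpha_iff {ν a : ℝ} (hν : 0 < ν) (ha : 0 ≤ a) :
    Tendsto (fun M : ℕ => normSup (noiseAlpha ν a M)) atTop (𝓝 0) ↔ a ≤ 1 := by
  simp only [normSup_noiseAlpha ν ha]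
  constructor
  · intro h
    by_contra! h1
    have hpos : 0 < √(∑' l : ℕ, (2 * (l : ℝ) + 1) / ((l : ℝ) + 1) ^ (2 * a)) :=
      Real.sqrt_pos.mpr ((summable_coeff h1).tsum_pos (fun l => by positivity) 0 (by simp))
    have h2 := ((tendsto_normTwo_of_one_lt h1).inv₀ hpos.ne').const_mul (√(2 * ν))
    have h3 := tendsto_nhds_unique h h2
    have : 0 < √(2 * ν) * (√(∑' l : ℕ, (2 * (l : ℝ) + 1) / ((l : ℝ) + 1) ^ (2 * a)))⁻¹ := by
      positivity
    exact this.ne h3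
  · intro h
    simpa using ((tendsto_normTwo_atTop h).inv_tendsto_atTop).const_mul (√(2 * ν))

/-! ### The Itô isometry for simple processes -/

lemma timeMeas_Ioc (a b : ℝ≥0) : timeMeas (Ioc a b) = ((b - a : ℝ≥0) : ℝ≥0∞) := by
  rcases le_total a b with h | h
  · rw [show Ioc a b = Iic b \ Iic a by ext; simp [and_comm],
      measure_sdiff (Iic_subset_Iic.mpr h) measurableSet_Iic.nullMeasurableSet
      (by simp [timeMeas_Iic]), timeMeas_Iic, timeMeas_Iic, ENNReal.coe_sub]
  · rw [Ioc_eq_empty (not_lt.mpr h), measure_empty, tsub_eq_zero_of_le h, ENNReal.coe_zero]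

instance isFiniteMeasure_timeMeas_restrict (t : ℝ≥0) :
    IsFiniteMeasure (timeMeas.restrict (Iic t)) :=
  ⟨by simp [timeMeas_Iic]⟩

lemma memLp_two_integrable_mul {α : Type*} {mα : MeasurableSpace α} {μ : Measure α} {f g : α → ℝ}
    (hf : MemLp f 2 μ) (hg : MemLp g 2 μ) : Integrable (fun x => f x * g x) μ :=
  hf.integrable_mul hg

/-- The `L²` inner product of (classes of) real functions. -/
lemma inner_toLp_eq_integral {α : Type*} {mα : MeasurableSpace α} {μ : Measure α} {f g : α → ℝ}
    (hf : MemLp f 2 μ) (hg : MemLp g 2 μ) :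
    inner ℝ (hf.toLp f) (hg.toLp g) = ∫ x, f x * g x ∂μ := by
  rw [L2.inner_def]
  refine integral_congr_ae ?_
  filter_upwards [hf.coeFn_toLp, hg.coeFn_toLp] with x h1 h2
  rw [h1, h2]
  simp [mul_comm]

lemma tendsto_integral_mul_of_tendsto_eLpNorm {α : Type*} {mα : MeasurableSpace α} {μ : Measure α}
    {f g : ℕ → α → ℝ} {f' g' : α → ℝ} (hf : ∀ n, MemLp (f n) 2 μ) (hg : ∀ n, MemLp (g n) 2 μ)
    (hf' : MemLp f' 2 μ) (hg' : MemLp g' 2 μ)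
    (h1 : Tendsto (fun n => eLpNorm (fun x => f n x - f' x) 2 μ) atTop (𝓝 0))
    (h2 : Tendsto (fun n => eLpNorm (fun x => g n x - g' x) 2 μ) atTop (𝓝 0)) :
    Tendsto (fun n => ∫ x, f n x * g n x ∂μ) atTop (𝓝 (∫ x, f' x * g' x ∂μ)) := by
  have e1 : Tendsto (fun n => (hf n).toLp (f n)) atTop (𝓝 (hf'.toLp f')) :=
    (Lp.tendsto_Lp_iff_tendsto_eLpNorm'' f hf f' hf').mpr h1
  have e2 : Tendsto (fun n => (hg n).toLp (g n)) atTop (𝓝 (hg'.toLp g')) :=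
    (Lp.tendsto_Lp_iff_tendsto_eLpNorm'' g hg g' hg').mpr h2
  simpa only [inner_toLp_eq_integral] using e1.inner (𝕜 := ℝ) e2

section ItoIsometry

variable {Ω ι : Type*} {mΩ : MeasurableSpace Ω} {P : Measure Ω}
  {𝓕 : Filtration ℝ≥0 mΩ} {B : ι → ℝ≥0 → Ω → ℝ}

lemma SimpleProc.val_eq_sum (S : SimpleProc 𝓕 P) (z : ℝ≥0 × Ω) : S.val z.1 z.2 =
    ∑ k ∈ Finset.range S.n,
      (Ioc (S.τ k) (S.τ (k + 1))).indicator (fun _ => (1 : ℝ)) z.1 * S.ξ k z.2 := by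
  refine Finset.sum_congr rfl fun k _ => ?_
  by_cases h : z.1 ∈ Ioc (S.τ k) (S.τ (k + 1)) <;> simp [h]

namespace IsBrownianFamily

lemma memLp_incr (hB : IsBrownianFamily 𝓕 P B) (i : ι) (s t : ℝ≥0) :
    MemLp (fun θ => B i t θ - B i s θ) 2 P := by
  have h := (hB.brownian i).hasLaw_sub t s
  have h2 := memLp_id_gaussianReal (μ := 0) (v := nndist t.1 s.1) 2
  rw [← h.map_eq] at h2
  exact (memLp_map_measure_iff aestronglyMeasurable_id h.aemeasurable).mp h2

lemma integral_incr (hB : IsBrownianFamily 𝓕 P B) (i : ι) (s t : ℝ≥0) :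
    ∫ θ, (B i t θ - B i s θ) ∂P = 0 := by
  rw [integral_sub ((hB.brownian i).integrable_eval t) ((hB.brownian i).integrable_eval s),
    (hB.brownian i).integral_eval, (hB.brownian i).integral_eval, sub_zero]

lemma indepFun_incr (hB : IsBrownianFamily 𝓕 P B) {s t : ℝ≥0} (hst : s ≤ t)
    {f : (ι → ℝ) → ℝ} (hf : Measurable f) {Z : Ω → ℝ} (hZ : StronglyMeasurable[𝓕 s] Z) :
    IndepFun Z (fun θ => f fun i => B i t θ - B i s θ) P := by
  rw [IndepFun_iff_Indep]
  refine (indep_of_indep_of_le_left (indep_of_indep_of_le_right (hB.indep_incr s t hst) ?_) ?_).symm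
  · exact hZ.measurable.comap_le
  · rintro _ ⟨A, hA, rfl⟩
    exact ⟨f ⁻¹' A, hf hA, rfl⟩

lemma integral_mul_incr (hB : IsBrownianFamily 𝓕 P B) (i : ι) {s t : ℝ≥0} (hst : s ≤ t)
    {Z : Ω → ℝ} (hZ : StronglyMeasurable[𝓕 s] Z) :
    ∫ θ, Z θ * (B i t θ - B i s θ) ∂P = 0 := by
  have h := hB.indepFun_incr hst (f := fun x => x i) (measurable_pi_apply i) hZ
  rw [h.integral_fun_mul_eq_mul_integral (hZ.mono (𝓕.le s)).aestronglyMeasurable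
    (hB.memLp_incr i s t).aestronglyMeasurable, hB.integral_incr, mul_zero]

lemma integral_incr_mul_incr [DecidableEq ι] (hB : IsBrownianFamily 𝓕 P B) (i j : ι) {s t : ℝ≥0}
    (hst : s ≤ t) : ∫ θ, (B i t θ - B i s θ) * (B j t θ - B j s θ) ∂P =
      if i = j then (t : ℝ) - s else 0 := by
  split_ifs with hij
  · subst hij
    have h1 := (hB.brownian i).hasLaw_sub t s
    have h2 := h1.variance_eq
    rw [variance_id_gaussianReal, variance_of_integral_eq_zero h1.aemeasurable
      (hB.integral_incr i s t)] at h2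
    simp only [Pi.sub_apply] at h2
    simp_rw [← sq]
    rw [h2, coe_nndist]
    simp only [NNReal.val_eq_coe, Real.dist_eq]
    exact abs_of_nonneg (sub_nonneg.mpr (NNReal.coe_le_coe.mpr hst))
  · have h := (hB.indep.indepFun hij).comp
      (φ := fun w : ℝ≥0 → ℝ => w t - w s) (ψ := fun w : ℝ≥0 → ℝ => w t - w s)
      (by fun_prop) (by fun_prop)
    have h2 := h.integral_fun_mul_eq_mul_integral (hB.memLp_incr i s t).aestronglyMeasurable
      (hB.memLp_incr j s t).aestronglyMeasurable
    simp only [Function.comp] at h2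
    rw [h2, hB.integral_incr, zero_mul]

lemma memLp_mul_incr (hB : IsBrownianFamily 𝓕 P B) (i : ι) {s t : ℝ≥0} (hst : s ≤ t)
    {Z : Ω → ℝ} (hZ : StronglyMeasurable[𝓕 s] Z) (hZ2 : MemLp Z 2 P) :
    MemLp (fun θ => Z θ * (B i t θ - B i s θ)) 2 P := by
  have h := hB.indepFun_incr hst (f := fun x => x i) (measurable_pi_apply i) hZ
  refine (memLp_two_iff_integrable_sq
    (hZ2.aestronglyMeasurable.mul (hB.memLp_incr i s t).aestronglyMeasurable)).mpr ?_
  have h2 := (h.comp (φ := fun x : ℝ => x ^ 2) (ψ := fun x : ℝ => x ^ 2)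
    (by fun_prop) (by fun_prop)).integrable_mul hZ2.integrable_sq (hB.memLp_incr i s t).integrable_sq
  refine h2.congr (Eventually.of_forall fun θ => ?_)
  simp [mul_pow]

/-- Increments over consecutive intervals are uncorrelated. -/
lemma integral_mul_incr_of_le (hB : IsBrownianFamily 𝓕 P B) (i j : ι) {a b c d : ℝ≥0}
    (hab : a ≤ b) (hbc : b ≤ c) (hcd : c ≤ d) {ξ η : Ω → ℝ}
    (hξ : StronglyMeasurable[𝓕 a] ξ) (hη : StronglyMeasurable[𝓕 c] η) :
    ∫ θ, (ξ θ * (B i b θ - B i a θ)) * (η θ * (B j d θ - B j c θ)) ∂P = 0 := by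
  have h1 : StronglyMeasurable[𝓕 c] (fun θ => (ξ θ * (B i b θ - B i a θ)) * η θ) :=
    ((hξ.mono (𝓕.mono (hab.trans hbc))).mul
      (((hB.adapted i b).mono (𝓕.mono hbc)).sub
        ((hB.adapted i a).mono (𝓕.mono (hab.trans hbc))))).mul hη
  have := hB.integral_mul_incr j hcd h1
  simpa only [mul_assoc] using this

/-- The covariance of two elementary stochastic integrals. -/
lemma integral_mul_incr_mul [DecidableEq ι] (hB : IsBrownianFamily 𝓕 P B) (i j : ι)
    {a b c d : ℝ≥0} (hab : a ≤ b) (hcd : c ≤ d) {ξ η : Ω → ℝ}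
    (hξ : StronglyMeasurable[𝓕 a] ξ) (hξ2 : MemLp ξ 2 P)
    (hη : StronglyMeasurable[𝓕 c] η) (hη2 : MemLp η 2 P) :
    ∫ θ, (ξ θ * (B i b θ - B i a θ)) * (η θ * (B j d θ - B j c θ)) ∂P =
      if i = j then (∫ θ, ξ θ * η θ ∂P) * timeMeas.real (Ioc a b ∩ Ioc c d) else 0 := by
  wlog hac : a ≤ c generalizing i j a b c d ξ η
  · have := this j i hcd hab hη hη2 hξ hξ2 (le_of_not_ge hac)
    simp only [eq_comm (a := j), mul_comm (η _), inter_comm (Ioc c d)] at this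
    rw [← this]
    refine integral_congr_ae (Eventually.of_forall fun θ => ?_)
    simp only
    ring
  rcases le_or_gt b c with hbc | hbc
  · rw [hB.integral_mul_incr_of_le i j hab hbc hcd hξ hη, Ioc_inter_Ioc,
      Ioc_eq_empty (by simp [hac, hbc])]
    simp
  -- split both intervals at `c` and at the smaller right end point `m`
  set m := min b d with hm
  have hcm : c ≤ m := le_min hbc.le hcd
  have hmb : m ≤ b := min_le_left _ _
  have hmd : m ≤ d := min_le_right _ _
  have hξc := hξ.mono (𝓕.mono hac)
  have hξm := hξ.mono (𝓕.mono (hac.trans hcm))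
  have hηm := hη.mono (𝓕.mono hcm)
  have u1 := hB.memLp_mul_incr i hac hξ hξ2
  have u2 := hB.memLp_mul_incr i hcm hξc hξ2
  have u3 := hB.memLp_mul_incr i hmb hξm hξ2
  have v1 := hB.memLp_mul_incr j hcm hη hη2
  have v2 := hB.memLp_mul_incr j hmd hηm hη2
  have z11 := hB.integral_mul_incr_of_le i j hac le_rfl hcm hξ hη
  have z12 := hB.integral_mul_incr_of_le i j hac hcm hmd hξ hηm
  have z22 := hB.integral_mul_incr_of_le i j hcm le_rfl hmd hξc hηm
  have z31 := hB.integral_mul_incr_of_le j i hcm le_rfl hmb hη hξm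
  have z32 : ∫ θ, (ξ θ * (B i b θ - B i m θ)) * (η θ * (B j d θ - B j m θ)) ∂P = 0 := by
    rcases min_choice b d with h | h
    · simp [hm, h]
    · simp [hm, h]
  have z21 : ∫ θ, (ξ θ * (B i m θ - B i c θ)) * (η θ * (B j m θ - B j c θ)) ∂P =
      if i = j then (∫ θ, ξ θ * η θ ∂P) * timeMeas.real (Ioc a b ∩ Ioc c d) else 0 := by
    have h := hB.indepFun_incr hcm (f := fun x => x i * x j)
      ((measurable_pi_apply i).mul (measurable_pi_apply j)) (hξc.mul hη)
    have h2 := h.integral_fun_mul_eq_mul_integral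
      (hξ2.aestronglyMeasurable.mul hη2.aestronglyMeasurable)
      ((hB.memLp_incr i c m).aestronglyMeasurable.mul (hB.memLp_incr j c m).aestronglyMeasurable)
    rw [hB.integral_incr_mul_incr i j hcm] at h2
    have e : timeMeas.real (Ioc a b ∩ Ioc c d) = (m : ℝ) - c := by
      rw [Ioc_inter_Ioc, sup_eq_right.mpr hac, measureReal_def, timeMeas_Ioc]
      exact NNReal.coe_sub hcm
    rw [e]
    calc _ = ∫ θ, (ξ * η) θ * ((B i m θ - B i c θ) * (B j m θ - B j c θ)) ∂P := by
          refine integral_congr_ae (Eventually.of_forall fun θ => ?_)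
          simp only [Pi.mul_apply]
          ring
      _ = _ := by
          rw [h2]
          split_ifs <;> simp
  have i11 := u1.integrable_mul v1
  have i12 := u1.integrable_mul v2
  have i21 := u2.integrable_mul v1
  have i22 := u2.integrable_mul v2
  have i31 := u3.integrable_mul v1
  have i32 := u3.integrable_mul v2
  have e : ∀ θ, (ξ θ * (B i b θ - B i a θ)) * (η θ * (B j d θ - B j c θ)) =
      (ξ θ * (B i c θ - B i a θ)) * (η θ * (B j m θ - B j c θ)) +
      (ξ θ * (B i c θ - B i a θ)) * (η θ * (B j d θ - B j m θ)) +
      (ξ θ * (B i m θ - B i c θ)) * (η θ * (B j m θ - B j c θ)) +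
      (ξ θ * (B i m θ - B i c θ)) * (η θ * (B j d θ - B j m θ)) +
      (η θ * (B j m θ - B j c θ)) * (ξ θ * (B i b θ - B i m θ)) +
      (ξ θ * (B i b θ - B i m θ)) * (η θ * (B j d θ - B j m θ)) := fun θ => by ring
  have i31' : Integrable (fun θ => (η θ * (B j m θ - B j c θ)) * (ξ θ * (B i b θ - B i m θ))) P :=
    v1.integrable_mul u3
  simp_rw [e]
  rw [integral_add, integral_add, integral_add, integral_add, integral_add, z11, z12, z21, z22, z31,
    z32]
  · ring
  · exact i11
  · exact i12
  · exact i11.add i12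
  · exact i21
  · exact (i11.add i12).add i21
  · exact i22
  · exact ((i11.add i12).add i21).add i22
  · exact i31'
  · exact (((i11.add i12).add i21).add i22).add i31'
  · exact i32

/-- The covariance of two elementary stochastic integrals, stopped at time `t`. -/
lemma integral_mul_incr_mul_min [DecidableEq ι] (hB : IsBrownianFamily 𝓕 P B) (i j : ι)
    {a b c d : ℝ≥0} (hab : a ≤ b) (hcd : c ≤ d) (t : ℝ≥0) {ξ η : Ω → ℝ}
    (hξ : StronglyMeasurable[𝓕 a] ξ) (hξ2 : MemLp ξ 2 P)
    (hη : StronglyMeasurable[𝓕 c] η) (hη2 : MemLp η 2 P) :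
    ∫ θ, (ξ θ * (B i (min b t) θ - B i (min a t) θ)) *
        (η θ * (B j (min d t) θ - B j (min c t) θ)) ∂P =
      if i = j then (∫ θ, ξ θ * η θ ∂P) * (timeMeas.restrict (Iic t)).real (Ioc a b ∩ Ioc c d)
        else 0 := by
  have hmeas : (timeMeas.restrict (Iic t)).real (Ioc a b ∩ Ioc c d) =
      timeMeas.real (Ioc a b ∩ Ioc c d ∩ Iic t) := by
    rw [measureReal_def, Measure.restrict_apply (measurableSet_Ioc.inter measurableSet_Ioc),
      measureReal_def]
  rw [hmeas]
  rcases lt_or_ge t a with hta | hta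
  · have : Ioc a b ∩ Ioc c d ∩ Iic t = ∅ := by
      ext x; simp only [mem_inter_iff, mem_Ioc, mem_Iic, mem_empty_iff_false, iff_false]
      rintro ⟨⟨⟨h1, _⟩, _⟩, h2⟩
      exact absurd (h1.trans_le h2) (not_lt.mpr hta.le)
    simp [this, min_eq_right hta.le, min_eq_right (hta.le.trans hab)]
  rcases lt_or_ge t c with htc | htc
  · have : Ioc a b ∩ Ioc c d ∩ Iic t = ∅ := by
      ext x; simp only [mem_inter_iff, mem_Ioc, mem_Iic, mem_empty_iff_false, iff_false]
      rintro ⟨⟨_, ⟨h1, _⟩⟩, h2⟩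
      exact absurd (h1.trans_le h2) (not_lt.mpr htc.le)
    simp [this, min_eq_right htc.le, min_eq_right (htc.le.trans hcd)]
  have : Ioc a b ∩ Ioc c d ∩ Iic t = Ioc a (min b t) ∩ Ioc c (min d t) := by
    ext x; simp only [mem_inter_iff, mem_Ioc, mem_Iic, le_min_iff]; tauto
  rw [this, min_eq_left hta, min_eq_left htc]
  exact hB.integral_mul_incr_mul i j (le_min hab hta) (le_min hcd htc) hξ hξ2 hη hη2

end IsBrownianFamily

namespace SimpleProc

lemma memLp_integral (hB : IsBrownianFamily 𝓕 P B) (i : ι) (S : SimpleProc 𝓕 P) (t : ℝ≥0) :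
    MemLp (S.integral (B i) t) 2 P := by
  refine memLp_finsetSum _ fun k _ => ?_
  rcases le_total t (S.τ k) with h | h
  · simp [min_eq_right h, min_eq_right (h.trans (S.mono k.le_succ))]
  · rw [min_eq_left h]
    exact hB.memLp_mul_incr i (le_min (S.mono k.le_succ) h) (S.meas k) (S.memLp k)

variable [IsProbabilityMeasure P]

lemma memLp_indicator_mul (t a b : ℝ≥0) {ξ : Ω → ℝ} (hξ : MemLp ξ 2 P) :
    MemLp (fun z : ℝ≥0 × Ω => (Ioc a b).indicator (fun _ => (1 : ℝ)) z.1 * ξ z.2) 2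
      ((timeMeas.restrict (Iic t)).prod P) := by
  have h1 : MemLp (fun z : ℝ≥0 × Ω => ξ z.2) 2 ((timeMeas.restrict (Iic t)).prod P) :=
    hξ.comp_snd _
  have h2 := h1.indicator (s := Prod.fst ⁻¹' Ioc a b) (measurable_fst measurableSet_Ioc)
  refine (memLp_congr_ae (Eventually.of_forall fun z => ?_)).mp h2
  by_cases h : z.1 ∈ Ioc a b <;> simp [indicator, h]

lemma memLp_val (S : SimpleProc 𝓕 P) (t : ℝ≥0) :
    MemLp (fun z : ℝ≥0 × Ω => S.val z.1 z.2) 2 ((timeMeas.restrict (Iic t)).prod P) := by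
  simp_rw [val_eq_sum]
  exact memLp_finsetSum _ fun k _ => memLp_indicator_mul t _ _ (S.memLp k)

/-- The Itô isometry in bilinear form, for simple processes: integrals against different Brownian
motions of the family are orthogonal. -/
theorem integral_mul_integral [DecidableEq ι] (hB : IsBrownianFamily 𝓕 P B) (i j : ι)
    (S S' : SimpleProc 𝓕 P) (t : ℝ≥0) :
    ∫ θ, S.integral (B i) t θ * S'.integral (B j) t θ ∂P =
      if i = j then ∫ z, S.val z.1 z.2 * S'.val z.1 z.2 ∂((timeMeas.restrict (Iic t)).prod P)
        else 0 := by
  have hl : ∫ θ, S.integral (B i) t θ * S'.integral (B j) t θ ∂P =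
      ∑ k ∈ Finset.range S.n, ∑ l ∈ Finset.range S'.n,
        if i = j then (∫ θ, S.ξ k θ * S'.ξ l θ ∂P) * (timeMeas.restrict (Iic t)).real
          (Ioc (S.τ k) (S.τ (k + 1)) ∩ Ioc (S'.τ l) (S'.τ (l + 1))) else 0 := by
    have hm : ∀ (i : ι) (S : SimpleProc 𝓕 P) (k : ℕ), MemLp (fun θ => S.ξ k θ *
        (B i (min (S.τ (k + 1)) t) θ - B i (min (S.τ k) t) θ)) 2 P := by
      intro i S k
      rcases le_total t (S.τ k) with h | h
      · simp [min_eq_right h, min_eq_right (h.trans (S.mono k.le_succ))]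
      · rw [min_eq_left h]
        exact hB.memLp_mul_incr i (le_min (S.mono k.le_succ) h) (S.meas k) (S.memLp k)
    simp only [SimpleProc.integral, Finset.sum_mul_sum]
    rw [integral_finsetSum _ fun k _ => integrable_finsetSum _ fun l _ =>
      memLp_two_integrable_mul (hm i S k) (hm j S' l)]
    refine Finset.sum_congr rfl fun k _ => ?_
    rw [integral_finsetSum _ fun l _ => memLp_two_integrable_mul (hm i S k) (hm j S' l)]
    refine Finset.sum_congr rfl fun l _ => ?_
    exact hB.integral_mul_incr_mul_min i j (S.mono k.le_succ) (S'.mono l.le_succ) t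
      (S.meas k) (S.memLp k) (S'.meas l) (S'.memLp l)
  have hr : ∫ z, S.val z.1 z.2 * S'.val z.1 z.2 ∂((timeMeas.restrict (Iic t)).prod P) =
      ∑ k ∈ Finset.range S.n, ∑ l ∈ Finset.range S'.n,
        (∫ θ, S.ξ k θ * S'.ξ l θ ∂P) * (timeMeas.restrict (Iic t)).real
          (Ioc (S.τ k) (S.τ (k + 1)) ∩ Ioc (S'.τ l) (S'.τ (l + 1))) := by
    have hm : ∀ (S : SimpleProc 𝓕 P) (k : ℕ), MemLp (fun z : ℝ≥0 × Ω =>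
        (Ioc (S.τ k) (S.τ (k + 1))).indicator (fun _ => (1 : ℝ)) z.1 * S.ξ k z.2) 2
        ((timeMeas.restrict (Iic t)).prod P) :=
      fun S k => memLp_indicator_mul t _ _ (S.memLp k)
    simp only [val_eq_sum, Finset.sum_mul_sum]
    rw [integral_finsetSum _ fun k _ => integrable_finsetSum _ fun l _ =>
      memLp_two_integrable_mul (hm S k) (hm S' l)]
    refine Finset.sum_congr rfl fun k _ => ?_
    rw [integral_finsetSum _ fun l _ => memLp_two_integrable_mul (hm S k) (hm S' l)]
    refine Finset.sum_congr rfl fun l _ => ?_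
    have := integral_prod_mul (μ := timeMeas.restrict (Iic t)) (ν := P)
      ((Ioc (S.τ k) (S.τ (k + 1)) ∩ Ioc (S'.τ l) (S'.τ (l + 1))).indicator fun _ => (1 : ℝ))
      (fun θ => S.ξ k θ * S'.ξ l θ)
    rw [integral_indicator_const _ (measurableSet_Ioc.inter measurableSet_Ioc), smul_eq_mul,
      mul_one] at this
    rw [mul_comm, ← this]
    refine integral_congr_ae (Eventually.of_forall fun z => ?_)
    beta_reduce
    rw [show ∀ x y u v : ℝ, x * y * (u * v) = (x * u) * (y * v) by intros; ring]
    congr 1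
    rw [← Set.inter_indicator_mul]
    simp
  rw [hl, hr]
  split_ifs <;> simp

end SimpleProc

/-- The Itô isometry in bilinear form: integrals against different Brownian motions of the family
are orthogonal. -/
theorem IsItoIntegral.integral_mul [IsProbabilityMeasure P] [DecidableEq ι]
    (hB : IsBrownianFamily 𝓕 P B) {i j : ι}
    {H H' : ℝ≥0 → Ω → ℝ} {t : ℝ≥0} {I I' : Ω → ℝ}
    (hH : MemLp (fun z : ℝ≥0 × Ω => H z.1 z.2) 2 ((timeMeas.restrict (Iic t)).prod P))
    (hH' : MemLp (fun z : ℝ≥0 × Ω => H' z.1 z.2) 2 ((timeMeas.restrict (Iic t)).prod P))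
    (hI : IsItoIntegral 𝓕 P (B i) H t I) (hI' : IsItoIntegral 𝓕 P (B j) H' t I') :
    ∫ θ, I θ * I' θ ∂P =
      if i = j then ∫ z, H z.1 z.2 * H' z.1 z.2 ∂((timeMeas.restrict (Iic t)).prod P) else 0 := by
  obtain ⟨hm, S, h1, h2⟩ := hI
  obtain ⟨hm', S', h1', h2'⟩ := hI'
  have hl := tendsto_integral_mul_of_tendsto_eLpNorm
    (fun n => (S n).memLp_integral hB i t) (fun n => (S' n).memLp_integral hB j t) hm hm' h2 h2'
  have hr := tendsto_integral_mul_of_tendsto_eLpNorm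
    (fun n => (S n).memLp_val t) (fun n => (S' n).memLp_val t) hH hH' h1 h1'
  refine tendsto_nhds_unique hl ?_
  simp_rw [SimpleProc.integral_mul_integral hB]
  split_ifs
  · exact hr
  · exact tendsto_const_nhds

/-- The Itô integral exists as soon as the integrand is an `L²`-limit of simple processes. -/
theorem exists_isItoIntegral_of_tendsto [IsProbabilityMeasure P]
    (hB : IsBrownianFamily 𝓕 P B) (i : ι)
    {H : ℝ≥0 → Ω → ℝ} {t : ℝ≥0}
    (hH : MemLp (fun z : ℝ≥0 × Ω => H z.1 z.2) 2 ((timeMeas.restrict (Iic t)).prod P))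
    (S : ℕ → SimpleProc 𝓕 P)
    (hS : Tendsto (fun n => eLpNorm (fun z : ℝ≥0 × Ω => (S n).val z.1 z.2 - H z.1 z.2) 2
      ((timeMeas.restrict (Iic t)).prod P)) atTop (𝓝 0)) :
    ∃ I, IsItoIntegral 𝓕 P (B i) H t I := by
  classical
  set V := fun n => ((S n).memLp_val t).toLp _ with hV
  set J := fun n => ((S n).memLp_integral hB i t).toLp _ with hJ
  have hinner : ∀ m n, inner ℝ (J m) (J n) = inner ℝ (V m) (V n) := by
    intro m n
    rw [hV, hJ, inner_toLp_eq_integral, inner_toLp_eq_integral,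
      SimpleProc.integral_mul_integral hB, if_pos rfl]
  have hdist : ∀ m n, dist (J m) (J n) = dist (V m) (V n) := by
    intro m n
    rw [dist_eq_norm, dist_eq_norm, @norm_eq_sqrt_real_inner, @norm_eq_sqrt_real_inner]
    simp only [inner_sub_left, inner_sub_right, hinner]
  have hVlim : Tendsto V atTop (𝓝 (hH.toLp _)) :=
    (Lp.tendsto_Lp_iff_tendsto_eLpNorm'' _ (fun n => (S n).memLp_val t) _ hH).mpr hS
  have hJc : CauchySeq J := by
    have := hVlim.cauchySeq
    rw [Metric.cauchySeq_iff] at this ⊢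
    simpa only [hdist] using this
  obtain ⟨I, hI⟩ := cauchySeq_tendsto_of_complete hJc
  refine ⟨I, Lp.memLp I, S, hS, ?_⟩
  have hI' : Tendsto J atTop (𝓝 ((Lp.memLp I).toLp I)) := by rwa [Lp.toLp_coeFn]
  exact (Lp.tendsto_Lp_iff_tendsto_eLpNorm'' _ (fun n => (S n).memLp_integral hB i t) _
    (Lp.memLp I)).mp hI'

end ItoIsometry

/-! ### Approximation by simple processes -/

/-- `((k-1)δ, kδ]` with `δ = t / (n+1)`; it is empty for `k = 0`. -/
def pastIoc (t : ℝ≥0) (n k : ℕ) : Set ℝ≥0 :=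
  Ioc (((k - 1 : ℕ) : ℝ≥0) * (t / (n + 1))) ((k : ℝ≥0) * (t / (n + 1)))

/-- The average of `h` over the grid interval that ends at the grid point `k t / (n+1)`. -/
noncomputable def pastAvg (t : ℝ≥0) (n : ℕ) (h : ℝ≥0 → ℝ) (k : ℕ) : ℝ :=
  ((t / (n + 1) : ℝ≥0) : ℝ)⁻¹ * ∫ s in pastIoc t n k, h s ∂(timeMeas.restrict (Iic t))

/-- The step function which takes on each interval of the grid the average of `h` over the
preceding interval. -/
noncomputable def stepApprox (t : ℝ≥0) (n : ℕ) (h : ℝ≥0 → ℝ) (s : ℝ≥0) : ℝ :=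
  ∑ k ∈ Finset.range (n + 1), (Ioc ((k : ℝ≥0) * (t / (n + 1)))
    (((k + 1 : ℕ) : ℝ≥0) * (t / (n + 1)))).indicator (fun _ => pastAvg t n h k) s

lemma measurableSet_pastIoc (t : ℝ≥0) (n k : ℕ) : MeasurableSet (pastIoc t n k) :=
  measurableSet_Ioc

lemma monotone_grid (δ : ℝ≥0) : Monotone fun k : ℕ => (k : ℝ≥0) * δ := fun i j hij => by
  simp only
  gcongr

lemma measure_grid_le (t δ : ℝ≥0) (k : ℕ) :
    (timeMeas.restrict (Iic t)).real (Ioc ((k : ℝ≥0) * δ) (((k + 1 : ℕ) : ℝ≥0) * δ)) ≤ δ := by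
  refine ENNReal.toReal_le_of_le_ofReal δ.2 ((Measure.restrict_apply_le _ _).trans ?_)
  have e : ((k + 1 : ℕ) : ℝ≥0) * δ - k * δ = δ := by
    rw [Nat.cast_add, Nat.cast_one, add_mul, one_mul, add_tsub_cancel_left]
  rw [timeMeas_Ioc, e]
  exact (ENNReal.ofReal_coe_nnreal (p := δ)).ge

lemma measure_pastIoc_le (t : ℝ≥0) (n k : ℕ) :
    (timeMeas.restrict (Iic t)).real (pastIoc t n k) ≤ (t / (n + 1) : ℝ≥0) := by
  rcases k with _ | k
  · rw [pastIoc, Nat.zero_sub, Ioc_self, measureReal_empty]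
    exact NNReal.coe_nonneg _
  · exact measure_grid_le t _ k

lemma sq_integral_le {α : Type*} {mα : MeasurableSpace α} {μ : Measure α} [IsFiniteMeasure μ]
    {h : α → ℝ} (hh : MemLp h 2 μ) :
    (∫ x, h x ∂μ) ^ 2 ≤ μ.real univ * ∫ x, h x ^ 2 ∂μ := by
  have h1 : MemLp (fun _ : α => (1 : ℝ)) 2 μ := memLp_const 1
  have := real_inner_mul_inner_self_le (h1.toLp _) (hh.toLp h)
  simp only [inner_toLp_eq_integral, one_mul, mul_one, integral_const, smul_eq_mul] at this
  simpa only [sq] using this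

lemma sq_pastAvg_le (t : ℝ≥0) (n k : ℕ) {h : ℝ≥0 → ℝ}
    (hh : MemLp h 2 (timeMeas.restrict (Iic t))) :
    ((t / (n + 1) : ℝ≥0) : ℝ) * pastAvg t n h k ^ 2 ≤
      ∫ s in pastIoc t n k, h s ^ 2 ∂(timeMeas.restrict (Iic t)) := by
  set δ : ℝ := ((t / (n + 1) : ℝ≥0) : ℝ) with hδ
  have hδ0 : 0 ≤ δ := NNReal.coe_nonneg _
  set J := ∫ s in pastIoc t n k, h s ^ 2 ∂(timeMeas.restrict (Iic t)) with hJ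
  have hJ0 : 0 ≤ J := integral_nonneg fun s => sq_nonneg _
  have h1 := sq_integral_le (hh.restrict (pastIoc t n k))
  rw [measureReal_restrict_apply_univ] at h1
  have h2 : (∫ s in pastIoc t n k, h s ∂(timeMeas.restrict (Iic t))) ^ 2 ≤ δ * J :=
    h1.trans (mul_le_mul_of_nonneg_right (measure_pastIoc_le t n k) hJ0)
  rw [pastAvg, mul_pow, ← hδ]
  rcases hδ0.eq_or_lt with h0 | h0
  · rw [← h0]; simpa using hJ0
  · calc _ ≤ δ * (δ⁻¹ ^ 2 * (δ * J)) := by gcongr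
      _ = J := by field_simp

lemma sq_stepApprox (t : ℝ≥0) (n : ℕ) (h : ℝ≥0 → ℝ) (s : ℝ≥0) :
    stepApprox t n h s ^ 2 = ∑ k ∈ Finset.range (n + 1), (Ioc ((k : ℝ≥0) * (t / (n + 1)))
      (((k + 1 : ℕ) : ℝ≥0) * (t / (n + 1)))).indicator (fun _ => pastAvg t n h k ^ 2) s := by
  rw [sq, stepApprox, Finset.sum_mul_sum]
  refine Finset.sum_congr rfl fun k hk => ?_
  rw [Finset.sum_eq_single_of_mem k hk]
  · rw [← inter_indicator_mul, inter_self, sq]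
  · intro l _ hlk
    have := (monotone_grid (t / (n + 1))).pairwise_disjoint_on_Ioc_succ hlk.symm
    rw [← inter_indicator_mul]
    simp only [Function.onFun, Nat.succ_eq_succ, Nat.succ_eq_add_one] at this
    rw [this.inter_eq, indicator_empty]

/-- Replacing `h` by its averages over preceding intervals is a contraction of `L²`. -/
lemma integral_sq_stepApprox_le (t : ℝ≥0) (n : ℕ) {h : ℝ≥0 → ℝ}
    (hh : MemLp h 2 (timeMeas.restrict (Iic t))) :
    ∫ s, stepApprox t n h s ^ 2 ∂(timeMeas.restrict (Iic t)) ≤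
      ∫ s, h s ^ 2 ∂(timeMeas.restrict (Iic t)) := by
  simp_rw [sq_stepApprox]
  rw [integral_finsetSum _ fun k _ => (integrable_const _).indicator measurableSet_Ioc]
  have hle : ∀ k ∈ Finset.range (n + 1), ∫ s, (Ioc ((k : ℝ≥0) * (t / (n + 1)))
      (((k + 1 : ℕ) : ℝ≥0) * (t / (n + 1)))).indicator (fun _ => pastAvg t n h k ^ 2) s
        ∂(timeMeas.restrict (Iic t)) ≤
      ∫ s in pastIoc t n k, h s ^ 2 ∂(timeMeas.restrict (Iic t)) := by
    intro k _
    rw [integral_indicator_const _ measurableSet_Ioc, smul_eq_mul]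
    exact (mul_le_mul_of_nonneg_right (measure_grid_le t _ k) (sq_nonneg _)).trans
      (sq_pastAvg_le t n k hh)
  refine (Finset.sum_le_sum hle).trans ?_
  rw [Finset.sum_range_succ']
  have h0 : pastIoc t n 0 = ∅ := by simp [pastIoc]
  rw [h0, setIntegral_empty, add_zero]
  have hd : Pairwise (Function.onFun Disjoint fun k => pastIoc t n (k + 1)) :=
    (monotone_grid (t / (n + 1))).pairwise_disjoint_on_Ioc_succ
  rw [← integral_biUnion_finset _ (fun k _ => measurableSet_pastIoc t n (k + 1))
    (hd.set_pairwise _) (fun k _ => hh.integrable_sq.integrableOn)]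
  exact setIntegral_le_integral hh.integrable_sq (Eventually.of_forall fun s => sq_nonneg _)

lemma memLp_stepApprox (t : ℝ≥0) (n : ℕ) (h : ℝ≥0 → ℝ) :
    MemLp (stepApprox t n h) 2 (timeMeas.restrict (Iic t)) :=
  memLp_finsetSum _ fun _ _ => (memLp_const _).indicator measurableSet_Ioc

lemma stepApprox_sub (t : ℝ≥0) (n : ℕ) {h g : ℝ≥0 → ℝ}
    (hh : Integrable h (timeMeas.restrict (Iic t))) (hg : Integrable g (timeMeas.restrict (Iic t)))
    (s : ℝ≥0) : stepApprox t n (fun s => h s - g s) s = stepApprox t n h s - stepApprox t n g s := by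
  simp only [stepApprox, ← Finset.sum_sub_distrib]
  refine Finset.sum_congr rfl fun k _ => ?_
  have : pastAvg t n (fun s => h s - g s) k = pastAvg t n h k - pastAvg t n g k := by
    rw [pastAvg, integral_sub hh.integrableOn hg.integrableOn, mul_sub, pastAvg, pastAvg]
  rw [this]
  exact congrFun (indicator_sub _ (fun _ => pastAvg t n h k) (fun _ => pastAvg t n g k)) s

lemma stepApprox_of_mem (t : ℝ≥0) (n : ℕ) (h : ℝ≥0 → ℝ) {s : ℝ≥0} {k : ℕ} (hk : k < n + 1)
    (hs : s ∈ Ioc ((k : ℝ≥0) * (t / (n + 1))) (((k + 1 : ℕ) : ℝ≥0) * (t / (n + 1)))) :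
    stepApprox t n h s = pastAvg t n h k := by
  rw [stepApprox, Finset.sum_eq_single_of_mem k (Finset.mem_range.mpr hk), indicator_of_mem hs]
  intro l _ hlk
  have := (monotone_grid (t / (n + 1))).pairwise_disjoint_on_Ioc_succ hlk.symm
  exact indicator_of_notMem (fun h' => this.le_bot ⟨hs, h'⟩) _

lemma exists_mem_grid {t s : ℝ≥0} (hs0 : 0 < s) (hst : s ≤ t) (n : ℕ) : ∃ k < n + 1,
    s ∈ Ioc ((k : ℝ≥0) * (t / (n + 1))) (((k + 1 : ℕ) : ℝ≥0) * (t / (n + 1))) := by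
  have hP : ∃ k : ℕ, s ≤ ((k + 1 : ℕ) : ℝ≥0) * (t / (n + 1)) := ⟨n, by
    push_cast
    rwa [mul_div_cancel₀]
    positivity⟩
  classical
  refine ⟨Nat.find hP, Nat.lt_succ_of_le (Nat.find_min' hP ?_), ?_, Nat.find_spec hP⟩
  · push_cast
    rwa [mul_div_cancel₀]
    positivity
  · rcases hk : Nat.find hP with _ | k
    · simpa using hs0
    · exact not_le.mp (Nat.find_min hP (m := k) (by omega))

lemma tendsto_stepApprox_of_continuous {g : ℝ≥0 → ℝ} (hg : Continuous g) {t s : ℝ≥0}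
    (hgi : Integrable g (timeMeas.restrict (Iic t))) (hs0 : 0 < s) (hst : s ≤ t) :
    Tendsto (fun n => stepApprox t n g s) atTop (𝓝 (g s)) := by
  rw [Metric.tendsto_atTop]
  intro ε hε
  obtain ⟨r, hr, hgr⟩ := Metric.continuous_iff.mp hg s (ε / 2) (half_pos hε)
  have ht0 : 0 < t := hs0.trans_le hst
  have hδlim : Tendsto (fun n : ℕ => (t : ℝ) * (1 / ((n : ℝ) + 1))) atTop (𝓝 0) := by
    simpa using (tendsto_one_div_add_atTop_nhds_zero_nat (𝕜 := ℝ)).const_mul (t : ℝ)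
  obtain ⟨N, hN⟩ := (hδlim.eventually (gt_mem_nhds (lt_min (half_pos hr)
    (NNReal.coe_pos.mpr hs0)))).exists_forall_of_atTop
  refine ⟨N, fun n hn => ?_⟩
  obtain ⟨k, hkn, hk⟩ := exists_mem_grid hs0 hst n
  set δ : ℝ≥0 := t / (n + 1) with hδ
  have hδpos : 0 < δ := by positivity
  have hδr : (δ : ℝ) < min (r / 2) s := by
    have := hN n hn
    rw [hδ]
    push_cast
    rwa [mul_one_div] at this
  -- since `δ < s`, the point `s` is not in the first interval
  obtain ⟨j, rfl⟩ : ∃ j, k = j + 1 := by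
    rcases k with _ | j
    · exfalso
      have h1 := hk.2
      simp only [zero_add, Nat.cast_one, one_mul] at h1
      exact absurd (NNReal.coe_le_coe.mpr h1) (not_le.mpr (hδr.trans_le (min_le_right _ _)))
    · exact ⟨j, rfl⟩
  rw [stepApprox_of_mem t n g hkn hk, Real.dist_eq]
  have hk1 : ((j : ℝ) + 1) * δ < s := by exact_mod_cast hk.1
  have hk2 : (s : ℝ) ≤ ((j : ℝ) + 1 + 1) * δ := by exact_mod_cast hk.2
  have hμ : (timeMeas.restrict (Iic t)).real (pastIoc t n (j + 1)) = δ := by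
    have hsub : pastIoc t n (j + 1) ⊆ Iic t := fun x hx => hx.2.trans (hk.1.le.trans hst)
    rw [measureReal_restrict_apply (measurableSet_pastIoc _ _ _), inter_eq_left.mpr hsub, pastIoc,
      measureReal_def, timeMeas_Ioc, ENNReal.coe_toReal, Nat.add_sub_cancel]
    push_cast
    rw [add_mul, one_mul, add_tsub_cancel_left]
  have e : pastAvg t n g (j + 1) - g s = (δ : ℝ)⁻¹ *
      ∫ u in pastIoc t n (j + 1), (g u - g s) ∂(timeMeas.restrict (Iic t)) := by
    rw [integral_sub hgi.integrableOn (integrable_const _), setIntegral_const, hμ, pastAvg,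
      mul_sub, smul_eq_mul, inv_mul_cancel_left₀ (NNReal.coe_pos.mpr hδpos).ne']
  have hb := norm_setIntegral_le_of_norm_le_const (μ := timeMeas.restrict (Iic t))
    (s := pastIoc t n (j + 1)) (f := fun u => g u - g s) (C := ε / 2) (measure_lt_top _ _)
    (fun u hu => by
      refine (hgr u ?_).le
      have h1 : (j : ℝ) * δ < u := by
        have := NNReal.coe_lt_coe.mpr hu.1
        rwa [← hδ, Nat.add_sub_cancel, NNReal.coe_mul, NNReal.coe_natCast] at this
      have h2 : (u : ℝ) ≤ ((j : ℝ) + 1) * δ := by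
        have := NNReal.coe_le_coe.mpr hu.2
        rwa [← hδ, NNReal.coe_mul, NNReal.coe_natCast, Nat.cast_add, Nat.cast_one] at this
      have h3 := hδr.trans_le (min_le_left _ _)
      rw [NNReal.dist_eq, abs_lt]
      constructor <;> linarith)
  rw [e, abs_mul, abs_inv, NNReal.abs_eq]
  rw [hμ, Real.norm_eq_abs] at hb
  calc _ ≤ (δ : ℝ)⁻¹ * (ε / 2 * δ) := by gcongr
    _ = ε / 2 := by field_simp
    _ < ε := half_lt_self hε

lemma abs_stepApprox_le (t : ℝ≥0) (n : ℕ) {g : ℝ≥0 → ℝ} {C : ℝ} (hC : 0 ≤ C)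
    (hg : ∀ s, |g s| ≤ C) (s : ℝ≥0) : |stepApprox t n g s| ≤ C := by
  by_cases hs : ∃ k ∈ Finset.range (n + 1),
      s ∈ Ioc ((k : ℝ≥0) * (t / (n + 1))) (((k + 1 : ℕ) : ℝ≥0) * (t / (n + 1)))
  · obtain ⟨k, hk, hs⟩ := hs
    rw [stepApprox_of_mem t n g (Finset.mem_range.mp hk) hs, pastAvg, abs_mul, abs_inv,
      NNReal.abs_eq]
    have hb := norm_setIntegral_le_of_norm_le_const (μ := timeMeas.restrict (Iic t))
      (s := pastIoc t n k) (f := g) (C := C) (measure_lt_top _ _) (fun u _ => hg u)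
    have hb2 := hb.trans (mul_le_mul_of_nonneg_left (measure_pastIoc_le t n k) hC)
    rw [Real.norm_eq_abs] at hb2
    calc _ ≤ ((t / (n + 1) : ℝ≥0) : ℝ)⁻¹ * (C * (t / (n + 1) : ℝ≥0)) := by gcongr
      _ = C * (((t / (n + 1) : ℝ≥0) : ℝ)⁻¹ * ((t / (n + 1) : ℝ≥0) : ℝ)) := by ring
      _ ≤ C * 1 := by gcongr; exact inv_mul_le_one
      _ = C := mul_one C
  · push Not at hs
    rw [stepApprox, Finset.sum_eq_zero fun k hk => indicator_of_notMem (hs k hk) _]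
    simpa using hC

lemma ae_pos_and_le (t : ℝ≥0) : ∀ᵐ s ∂(timeMeas.restrict (Iic t)), 0 < s ∧ s ≤ t := by
  have h1 : ∀ᵐ s ∂(timeMeas.restrict (Iic t)), s ≤ t := ae_restrict_mem measurableSet_Iic
  have h2 : ∀ᵐ s ∂(timeMeas.restrict (Iic t)), s ≠ 0 := by
    refine ae_restrict_of_ae ?_
    rw [ae_iff]
    have : {a : ℝ≥0 | ¬ a ≠ 0} = Iic 0 := by ext; simp
    rw [this, timeMeas_Iic, ENNReal.coe_zero]
  filter_upwards [h1, h2] with s h1 h2 using ⟨pos_iff_ne_zero.mpr h2, h1⟩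

/-- The step functions converge in `L²`. -/
lemma tendsto_integral_sq_stepApprox_sub (t : ℝ≥0) {h : ℝ≥0 → ℝ}
    (hh : MemLp h 2 (timeMeas.restrict (Iic t))) :
    Tendsto (fun n => ∫ s, (stepApprox t n h s - h s) ^ 2 ∂(timeMeas.restrict (Iic t))) atTop
      (𝓝 0) := by
  set μ := timeMeas.restrict (Iic t) with hμ
  rw [Metric.tendsto_atTop]
  intro ε hε
  -- `ε / 12` bounds each of three squares, whose sum enters with the factor `3`
  obtain ⟨g, hg, hg2⟩ := MemLp.exists_boundedContinuous_integral_rpow_sub_le (μ := μ) (p := 2)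
    two_pos (by simpa using hh) (show 0 < ε / 12 by positivity)
  simp only [Real.norm_eq_abs, Real.rpow_two, sq_abs] at hg
  have hg2 : MemLp g 2 μ := by simpa using hg2
  have hlim : Tendsto (fun n => ∫ s, (stepApprox t n g s - g s) ^ 2 ∂μ) atTop (𝓝 0) := by
    have := tendsto_integral_of_dominated_convergence (μ := μ)
      (F := fun n s => (stepApprox t n g s - g s) ^ 2) (f := fun _ => (0 : ℝ))
      (fun _ => (2 * ‖g‖) ^ 2)
      (fun n => (((memLp_stepApprox t n g).sub hg2).aestronglyMeasurable.pow 2))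
      (integrable_const _)
      (fun n => Eventually.of_forall fun s => by
        rw [Real.norm_eq_abs, abs_of_nonneg (sq_nonneg _)]
        refine sq_le_sq' ?_ ?_
        · have h1 := (abs_le.mp (abs_stepApprox_le t n (norm_nonneg g) g.norm_coe_le_norm s)).1
          have h2 := (abs_le.mp (g.norm_coe_le_norm s)).2
          linarith
        · have h1 := (abs_le.mp (abs_stepApprox_le t n (norm_nonneg g) g.norm_coe_le_norm s)).2
          have h2 := (abs_le.mp (g.norm_coe_le_norm s)).1
          linarith)
      (by
        filter_upwards [ae_pos_and_le t] with s hs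
        have := ((tendsto_stepApprox_of_continuous g.continuous
          (hg2.integrable one_le_two) hs.1 hs.2).sub_const (g s)).pow 2
        simpa using this)
    simpa using this
  obtain ⟨N, hN⟩ :=
    (hlim.eventually (gt_mem_nhds (show 0 < ε / 12 by positivity))).exists_forall_of_atTop
  refine ⟨N, fun n hn => ?_⟩
  rw [Real.dist_eq, sub_zero, abs_of_nonneg (integral_nonneg fun s => sq_nonneg _)]
  have hd : MemLp (fun s => h s - g s) 2 μ := hh.sub hg2
  have h1 := integral_sq_stepApprox_le t n hd
  have e := stepApprox_sub t n (hh.integrable one_le_two) (hg2.integrable one_le_two)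
  have i1 : Integrable (fun s => (stepApprox t n h s - stepApprox t n g s) ^ 2) μ :=
    ((memLp_stepApprox t n h).sub (memLp_stepApprox t n g)).integrable_sq
  have i2 : Integrable (fun s => (stepApprox t n g s - g s) ^ 2) μ :=
    ((memLp_stepApprox t n g).sub hg2).integrable_sq
  have i3 : Integrable (fun s => (h s - g s) ^ 2) μ := hd.integrable_sq
  have i4 : Integrable (fun s => (stepApprox t n h s - h s) ^ 2) μ :=
    ((memLp_stepApprox t n h).sub hh).integrable_sq
  simp only [e] at h1
  calc ∫ s, (stepApprox t n h s - h s) ^ 2 ∂μ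
      ≤ ∫ s, 3 * ((stepApprox t n h s - stepApprox t n g s) ^ 2 +
          (stepApprox t n g s - g s) ^ 2 + (h s - g s) ^ 2) ∂μ := by
        refine integral_mono i4 (((i1.add i2).add i3).const_mul 3) fun s => ?_
        simp only
        nlinarith [sq_nonneg (stepApprox t n h s - stepApprox t n g s - (stepApprox t n g s - g s)),
          sq_nonneg (stepApprox t n h s - stepApprox t n g s + (h s - g s)),
          sq_nonneg (stepApprox t n g s - g s + (h s - g s))]
    _ = 3 * (∫ s, (stepApprox t n h s - stepApprox t n g s) ^ 2 ∂μ +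
          ∫ s, (stepApprox t n g s - g s) ^ 2 ∂μ + ∫ s, (h s - g s) ^ 2 ∂μ) := by
        rw [integral_const_mul, integral_add ?_ i3, integral_add i1 i2]
        exact i1.add i2
    _ < ε := by linarith [hN n hn]

section Existence

variable {Ω ι : Type*} {mΩ : MeasurableSpace Ω} {P : Measure Ω} {𝓕 : Filtration ℝ≥0 mΩ}

/-- An integral of a progressively measurable process over a time set before `r` is
`𝓕 r`-measurable. -/
lemma stronglyMeasurable_setIntegral {H : ℝ≥0 → Ω → ℝ} (hH : IsStronglyProgressive 𝓕 H)
    (t r : ℝ≥0) {A : Set ℝ≥0} (hA : MeasurableSet A) (hAr : A ⊆ Iic r) :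
    StronglyMeasurable[𝓕 r] fun θ => ∫ s in A, H s θ ∂(timeMeas.restrict (Iic t)) := by
  have h1 : StronglyMeasurable[Subtype.instMeasurableSpace.prod (𝓕 r)]
      (((fun p : Iic r × Ω => (p.1 : ℝ≥0)) ⁻¹' A).indicator fun p : Iic r × Ω => H p.1 p.2) :=
    @StronglyMeasurable.indicator _ _ _ (Subtype.instMeasurableSpace.prod (𝓕 r)) _ _ (hH r) _
      ((measurable_subtype_coe.comp (@measurable_fst _ _ _ (𝓕 r))) hA)
  have h2 := @StronglyMeasurable.integral_prod_left' (Iic r) Ω ℝ _ (𝓕 r)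
    ((timeMeas.restrict (Iic t)).comap Subtype.val) _ _ _ _ h1
  convert h2 using 1
  ext θ
  have h3 := integral_subtype_comap (μ := timeMeas.restrict (Iic t)) (s := Iic r)
    measurableSet_Iic (fun s => A.indicator (fun s => H s θ) s)
  rw [integral_indicator hA, Measure.restrict_restrict hA, inter_eq_left.mpr hAr] at h3
  exact h3.symm

variable {H : ℝ≥0 → Ω → ℝ} {t : ℝ≥0}

lemma ae_memLp_path
    (hH : MemLp (fun z : ℝ≥0 × Ω => H z.1 z.2) 2 ((timeMeas.restrict (Iic t)).prod P))
    [IsFiniteMeasure P] :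
    ∀ᵐ θ ∂P, MemLp (fun s => H s θ) 2 (timeMeas.restrict (Iic t)) := by
  filter_upwards [(hH.integrable one_le_two).prod_left_ae, hH.integrable_sq.prod_left_ae]
    with θ h1 h2
  exact (memLp_two_iff_integrable_sq h1.aestronglyMeasurable).mpr h2

variable [IsProbabilityMeasure P]

lemma memLp_pastAvg (hp : IsStronglyProgressive 𝓕 H)
    (hH : MemLp (fun z : ℝ≥0 × Ω => H z.1 z.2) 2 ((timeMeas.restrict (Iic t)).prod P))
    (n k : ℕ) : MemLp (fun θ => pastAvg t n (fun s => H s θ) k) 2 P := by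
  have hm : StronglyMeasurable fun θ => pastAvg t n (fun s => H s θ) k :=
    ((stronglyMeasurable_setIntegral hp t _ (measurableSet_pastIoc t n k)
      fun _ hx => hx.2).const_mul _).mono (𝓕.le _)
  refine (memLp_two_iff_integrable_sq hm.aestronglyMeasurable).mpr ?_
  have hi : Integrable (fun θ => ∫ s, H s θ ^ 2 ∂(timeMeas.restrict (Iic t))) P :=
    hH.integrable_sq.integral_prod_right
  refine (hi.const_mul ((t / (n + 1) : ℝ≥0) : ℝ)⁻¹).mono' (hm.aestronglyMeasurable.pow 2) ?_
  filter_upwards [ae_memLp_path hH] with θ hθ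
  rw [Real.norm_eq_abs, abs_of_nonneg (sq_nonneg _)]
  have h1 := (sq_pastAvg_le t n k hθ).trans
    (setIntegral_le_integral hθ.integrable_sq (Eventually.of_forall fun s => sq_nonneg _))
  rcases (NNReal.coe_nonneg (t / (n + 1))).eq_or_lt with h0 | h0
  · rw [pastAvg, ← h0]; simp
  · rw [inv_mul_eq_div, le_div_iff₀ h0, mul_comm]
    exact h1

/-- The simple process obtained from `H` by averaging in time over preceding grid intervals;
looking only at the past keeps it adapted. -/
noncomputable def gridProc (hp : IsStronglyProgressive 𝓕 H)
    (hH : MemLp (fun z : ℝ≥0 × Ω => H z.1 z.2) 2 ((timeMeas.restrict (Iic t)).prod P))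
    (n : ℕ) : SimpleProc 𝓕 P where
  n := n + 1
  τ k := (k : ℝ≥0) * (t / (n + 1))
  mono := monotone_grid _
  ξ k θ := pastAvg t n (fun s => H s θ) k
  meas k := (stronglyMeasurable_setIntegral hp t _ (measurableSet_pastIoc t n k)
      fun _ hx => hx.2).const_mul _
  memLp k := memLp_pastAvg hp hH n k

lemma tendsto_eLpNorm_gridProc (hp : IsStronglyProgressive 𝓕 H)
    (hH : MemLp (fun z : ℝ≥0 × Ω => H z.1 z.2) 2 ((timeMeas.restrict (Iic t)).prod P)) :
    Tendsto (fun n => eLpNorm (fun z : ℝ≥0 × Ω => (gridProc hp hH n).val z.1 z.2 - H z.1 z.2) 2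
      ((timeMeas.restrict (Iic t)).prod P)) atTop (𝓝 0) := by
  have hD : ∀ n, MemLp (fun z : ℝ≥0 × Ω => (gridProc hp hH n).val z.1 z.2 - H z.1 z.2) 2
      ((timeMeas.restrict (Iic t)).prod P) := fun n => ((gridProc hp hH n).memLp_val t).sub hH
  have hval : ∀ n s θ, (gridProc hp hH n).val s θ = stepApprox t n (fun s => H s θ) s :=
    fun n s θ => rfl
  have hint : ∀ n, ∫ z, ((gridProc hp hH n).val z.1 z.2 - H z.1 z.2) ^ 2
      ∂((timeMeas.restrict (Iic t)).prod P) =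
      ∫ θ, ∫ s, (stepApprox t n (fun s => H s θ) s - H s θ) ^ 2 ∂(timeMeas.restrict (Iic t)) ∂P :=
    fun n => integral_prod_symm _ (hD n).integrable_sq
  have hi : Integrable (fun θ => ∫ s, H s θ ^ 2 ∂(timeMeas.restrict (Iic t))) P :=
    hH.integrable_sq.integral_prod_right
  have hlim : Tendsto (fun n => ∫ z, ((gridProc hp hH n).val z.1 z.2 - H z.1 z.2) ^ 2
      ∂((timeMeas.restrict (Iic t)).prod P)) atTop (𝓝 0) := by
    simp_rw [hint]
    have := tendsto_integral_of_dominated_convergence (μ := P)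
      (F := fun n θ => ∫ s, (stepApprox t n (fun s => H s θ) s - H s θ) ^ 2
        ∂(timeMeas.restrict (Iic t))) (f := fun _ => (0 : ℝ))
      (fun θ => 4 * ∫ s, H s θ ^ 2 ∂(timeMeas.restrict (Iic t)))
      (fun n => (hD n).integrable_sq.integral_prod_right.aestronglyMeasurable)
      (hi.const_mul 4)
      (fun n => by
        filter_upwards [ae_memLp_path hH] with θ hθ
        rw [Real.norm_eq_abs, abs_of_nonneg (integral_nonneg fun s => sq_nonneg _)]
        have h1 := integral_sq_stepApprox_le t n hθ
        have i1 := (memLp_stepApprox t n fun s => H s θ).integrable_sq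
        have i2 := hθ.integrable_sq
        calc ∫ s, (stepApprox t n (fun s => H s θ) s - H s θ) ^ 2 ∂(timeMeas.restrict (Iic t))
            ≤ ∫ s, 2 * (stepApprox t n (fun s => H s θ) s ^ 2 + H s θ ^ 2)
                ∂(timeMeas.restrict (Iic t)) := by
              refine integral_mono
                ((memLp_stepApprox t n fun s => H s θ).sub hθ).integrable_sq
                ((i1.add i2).const_mul 2) fun s => ?_
              simp only
              nlinarith [sq_nonneg (stepApprox t n (fun s => H s θ) s + H s θ)]
          _ = 2 * (∫ s, stepApprox t n (fun s => H s θ) s ^ 2 ∂(timeMeas.restrict (Iic t)) +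
                ∫ s, H s θ ^ 2 ∂(timeMeas.restrict (Iic t))) := by
              rw [integral_const_mul, integral_add i1 i2]
          _ ≤ _ := by linarith)
      (by
        filter_upwards [ae_memLp_path hH] with θ hθ
        exact tendsto_integral_sq_stepApprox_sub t hθ)
    simpa using this
  have hsq := (hlim.sqrt)
  rw [Real.sqrt_zero] at hsq
  have := ENNReal.tendsto_ofReal hsq
  rw [ENNReal.ofReal_zero] at this
  refine this.congr fun n => ?_
  rw [(hD n).eLpNorm_eq_integral_rpow_norm two_ne_zero ENNReal.ofNat_ne_top, Real.sqrt_eq_rpow]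
  simp [sq_abs]

/-- A progressively measurable square integrable process has an Itô integral. -/
theorem exists_isItoIntegral {B : ι → ℝ≥0 → Ω → ℝ} (hB : IsBrownianFamily 𝓕 P B) (i : ι)
    (hp : IsStronglyProgressive 𝓕 H)
    (hH : MemLp (fun z : ℝ≥0 × Ω => H z.1 z.2) 2 ((timeMeas.restrict (Iic t)).prod P)) :
    ∃ I, IsItoIntegral 𝓕 P (B i) H t I :=
  exists_isItoIntegral_of_tendsto hB i hH (gridProc hp hH) (tendsto_eLpNorm_gridProc hp hH)

/-- Second moment of a finite sum of Itô integrals against different Brownian motions. -/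
theorem integral_sq_sum_itoIntegral {B : ι → ℝ≥0 → Ω → ℝ} (hB : IsBrownianFamily 𝓕 P B)
    {K : ι → ℝ≥0 → Ω → ℝ} (hp : ∀ i, IsStronglyProgressive 𝓕 (K i))
    (hK : ∀ i, MemLp (fun z : ℝ≥0 × Ω => K i z.1 z.2) 2 ((timeMeas.restrict (Iic t)).prod P))
    (A : Finset ι) :
    ∫ θ, (∑ i ∈ A, itoIntegral 𝓕 P (B i) (K i) t θ) ^ 2 ∂P =
      ∑ i ∈ A, ∫ z, K i z.1 z.2 ^ 2 ∂((timeMeas.restrict (Iic t)).prod P) := by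
  classical
  have hI : ∀ i, IsItoIntegral 𝓕 P (B i) (K i) t (itoIntegral 𝓕 P (B i) (K i) t) := by
    intro i
    have h := exists_isItoIntegral hB i (hp i) (hK i)
    rw [itoIntegral, dif_pos h]
    exact h.choose_spec
  simp_rw [sq, Finset.sum_mul_sum]
  rw [integral_finsetSum _ fun i _ => integrable_finsetSum _ fun j _ =>
    memLp_two_integrable_mul (hI i).1 (hI j).1]
  refine Finset.sum_congr rfl fun i hi => ?_
  rw [integral_finsetSum _ fun j _ => memLp_two_integrable_mul (hI i).1 (hI j).1]
  simp_rw [IsItoIntegral.integral_mul hB (hK i) (hK _) (hI i) (hI _)]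
  rw [Finset.sum_ite_eq, if_pos hi]

end Existence

/-! ### Integrals of polynomials over the sphere -/

open MvPolynomial in
/-- The polynomial function on `ℝ³` of a polynomial in three variables. -/
noncomputable def evalR3 (p : MvPolynomial (Fin 3) ℝ) (x : R3) : ℝ := eval x.ofLp p

open MvPolynomial in
/-- The gradient of a polynomial function on `ℝ³`. -/
noncomputable def polyGrad (p : MvPolynomial (Fin 3) ℝ) (x : R3) : R3 :=
  WithLp.toLp 2 fun i => evalR3 (pderiv i p) x

@[simp] lemma evalR3_add (p q : MvPolynomial (Fin 3) ℝ) (x : R3) :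
    evalR3 (p + q) x = evalR3 p x + evalR3 q x := map_add _ _ _

@[simp] lemma evalR3_sub (p q : MvPolynomial (Fin 3) ℝ) (x : R3) :
    evalR3 (p - q) x = evalR3 p x - evalR3 q x := map_sub _ _ _

@[simp] lemma evalR3_mul (p q : MvPolynomial (Fin 3) ℝ) (x : R3) :
    evalR3 (p * q) x = evalR3 p x * evalR3 q x := map_mul _ _ _

@[simp] lemma evalR3_X (i : Fin 3) (x : R3) : evalR3 (MvPolynomial.X i) x = x i :=
  MvPolynomial.eval_X i

@[simp] lemma evalR3_C (c : ℝ) (x : R3) : evalR3 (MvPolynomial.C c) x = c :=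
  MvPolynomial.eval_C c

@[simp] lemma polyGrad_apply (p : MvPolynomial (Fin 3) ℝ) (x : R3) (i : Fin 3) :
    polyGrad p x i = evalR3 (MvPolynomial.pderiv i p) x := rfl

lemma hasFDerivAt_evalR3 (p : MvPolynomial (Fin 3) ℝ) (x : R3) :
    HasFDerivAt (evalR3 p) (innerSL ℝ (polyGrad p x)) x := by
  induction p using MvPolynomial.induction_on with
  | C c =>
    have h1 : evalR3 (MvPolynomial.C c) = fun _ => c := funext (evalR3_C c)
    rw [h1]
    refine (hasFDerivAt_const c x).congr_fderiv ?_
    ext v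
    simp [PiLp.inner_apply, evalR3]
  | add p q hp hq =>
    have h1 : evalR3 (p + q) = fun x => evalR3 p x + evalR3 q x := funext (evalR3_add p q)
    rw [h1]
    refine (hp.fun_add hq).congr_fderiv ?_
    ext v
    simp [PiLp.inner_apply, Finset.sum_add_distrib, mul_add]
  | mul_X p j hp =>
    have h1 : evalR3 (p * MvPolynomial.X j) = fun x => evalR3 p x * x j :=
      funext fun x => by simp
    have hj : HasFDerivAt (fun x : R3 => x j) (EuclideanSpace.proj j : R3 →L[ℝ] ℝ) x :=
      (EuclideanSpace.proj j : R3 →L[ℝ] ℝ).hasFDerivAt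
    rw [h1]
    refine (hp.fun_mul hj).congr_fderiv ?_
    ext v
    fin_cases j <;>
    · simp [PiLp.inner_apply, Fin.sum_univ_three, Derivation.leibniz, MvPolynomial.pderiv_X,
        evalR3, Pi.single_apply]
      ring

lemma continuous_evalR3 (p : MvPolynomial (Fin 3) ℝ) : Continuous (evalR3 p) :=
  continuous_iff_continuousAt.mpr fun x => (hasFDerivAt_evalR3 p x).continuousAt

lemma evalR3_smul {p : MvPolynomial (Fin 3) ℝ} {d : ℕ} (hp : p.IsHomogeneous d) (r : ℝ) (x : R3) :
    evalR3 p (r • x) = r ^ d * evalR3 p x := by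
  simp only [evalR3, MvPolynomial.eval_eq, Finset.mul_sum, WithLp.ofLp_smul, Pi.smul_apply,
    smul_eq_mul, mul_pow, Finset.prod_mul_distrib]
  refine Finset.sum_congr rfl fun m hm => ?_
  rw [Finset.prod_pow_eq_pow_sum, ← hp.degree_eq_sum_deg_support hm]
  ring

instance isFiniteMeasure_surf : IsFiniteMeasure surf := by
  unfold surf
  infer_instance

/-- Integration in polar coordinates of functions `r y ↦ f y * g r`. -/
lemma integral_polar {F : R3 → ℝ} {f : S2 → ℝ} {g : ℝ → ℝ}
    (hF : ∀ (y : S2) (r : ℝ), 0 < r → F (r • (y : R3)) = f y * g r)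
    (hf : Integrable f surf) (hg : IntegrableOn (fun r => r ^ 2 * g r) (Ioi 0)) :
    Integrable F ∧ ∫ x, F x = (∫ y, f y ∂surf) * ∫ r in Ioi (0 : ℝ), r ^ 2 * g r := by
  have hdim : Module.finrank ℝ R3 - 1 = 2 := by simp
  have hmp := (volume : Measure R3).measurePreserving_homeomorphUnitSphereProd
  rw [hdim] at hmp
  have hcomp : ∀ x : ({0}ᶜ : Set R3), F x =
      (fun z : S2 × Ioi (0 : ℝ) => f z.1 * g z.2) (homeomorphUnitSphereProd R3 x) := by
    intro x
    have h1 := hF (homeomorphUnitSphereProd R3 x).1 (homeomorphUnitSphereProd R3 x).2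
      (homeomorphUnitSphereProd R3 x).2.2
    refine Eq.trans ?_ h1
    rw [← homeomorphUnitSphereProd_symm_apply_coe, Homeomorph.symm_apply_apply]
  have hgi : Integrable (fun r : Ioi (0 : ℝ) => g r) (Measure.volumeIoiPow 2) := by
    rw [Measure.volumeIoiPow, integrable_withDensity_iff_integrable_smul' (by fun_prop) (by simp)]
    rw [integrableOn_iff_comap_subtypeVal measurableSet_Ioi] at hg
    refine hg.congr (Eventually.of_forall fun r => ?_)
    have := r.2.out
    simp [ENNReal.toReal_ofReal, sq_nonneg]
  have hgv : ∫ r : Ioi (0 : ℝ), g r ∂(Measure.volumeIoiPow 2) =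
      ∫ r in Ioi (0 : ℝ), r ^ 2 * g r := by
    simp only [Measure.volumeIoiPow, ENNReal.ofReal]
    rw [integral_withDensity_eq_integral_smul (by fun_prop),
      integral_subtype_comap measurableSet_Ioi fun a => Real.toNNReal (a ^ 2) • g a]
    refine setIntegral_congr_fun measurableSet_Ioi fun x hx => ?_
    simp only [NNReal.smul_def, Real.coe_toNNReal _ (sq_nonneg x), smul_eq_mul]
  have hprod := Integrable.mul_prod hf hgi
  constructor
  · have h1 : Integrable (fun x : ({0}ᶜ : Set R3) => F x) ((volume : Measure R3).comap (↑)) := by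
      simp_rw [hcomp]
      exact (hmp.integrable_comp_emb (Homeomorph.measurableEmbedding _)).mpr hprod
    have h2 := (integrableOn_iff_comap_subtypeVal (measurableSet_singleton (0 : R3)).compl).mpr h1
    rwa [IntegrableOn, restrict_compl_singleton] at h2
  · calc ∫ x, F x = ∫ x : ({0}ᶜ : Set R3), F x ∂((volume : Measure R3).comap (↑)) := by
          rw [integral_subtype_comap (measurableSet_singleton _).compl F, restrict_compl_singleton]
      _ = ∫ z, f z.1 * g z.2 ∂(surf.prod (Measure.volumeIoiPow 2)) := by
          simp_rw [hcomp]
          exact hmp.integral_comp (Homeomorph.measurableEmbedding _)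
            fun z : S2 × Ioi (0 : ℝ) => f z.1 * g z.2
      _ = _ := by
          rw [← hgv]
          exact integral_prod_mul f fun r : Ioi (0 : ℝ) => g r

/-- The radial factors `∫_0^∞ r^{d+2} e^{-r²} dr` of Gaussian integrals of homogeneous functions. -/
noncomputable def gaussMoment (d : ℕ) : ℝ := ∫ r in Ioi (0 : ℝ), r ^ 2 * (r ^ d * Real.exp (-r ^ 2))

lemma integrableOn_gaussMoment (d : ℕ) :
    IntegrableOn (fun r : ℝ => r ^ 2 * (r ^ d * Real.exp (-r ^ 2))) (Ioi 0) := by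
  have := integrableOn_rpow_mul_exp_neg_mul_sq one_pos (s := ((d + 2 : ℕ) : ℝ))
    (by linarith [(Nat.cast_nonneg (d + 2) : (0 : ℝ) ≤ ((d + 2 : ℕ) : ℝ))])
  refine this.congr_fun (fun r _ => ?_) measurableSet_Ioi
  simp only [Real.rpow_natCast]
  ring_nf

lemma gaussMoment_eq (d : ℕ) : gaussMoment d = 1 / 2 * Real.Gamma (((d : ℝ) + 3) / 2) := by
  have := integral_rpow_mul_exp_neg_rpow (p := 2) (q := ((d + 2 : ℕ) : ℝ)) two_pos
    (by linarith [(Nat.cast_nonneg (d + 2) : (0 : ℝ) ≤ ((d + 2 : ℕ) : ℝ))])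
  rw [show ((d : ℝ) + 3) / 2 = (((d + 2 : ℕ) : ℝ) + 1) / 2 by push_cast; ring, ← this, gaussMoment]
  refine setIntegral_congr_fun measurableSet_Ioi fun r _ => ?_
  simp only [Real.rpow_natCast, Real.rpow_two]
  ring

lemma gaussMoment_pos (d : ℕ) : 0 < gaussMoment d := by
  rw [gaussMoment_eq]
  have := Real.Gamma_pos_of_pos (show 0 < ((d : ℝ) + 3) / 2 by positivity)
  positivity

lemma gaussMoment_add_two (d : ℕ) : gaussMoment (d + 2) = ((d : ℝ) + 3) / 2 * gaussMoment d := by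
  rw [gaussMoment_eq, gaussMoment_eq]
  have := Real.Gamma_add_one (show ((d : ℝ) + 3) / 2 ≠ 0 by positivity)
  rw [show (((d + 2 : ℕ) : ℝ) + 3) / 2 = ((d : ℝ) + 3) / 2 + 1 by push_cast; ring, this]
  ring

lemma integrable_of_continuous {f : S2 → ℝ} (hf : Continuous f) : Integrable f surf :=
  hf.integrable_of_hasCompactSupport (HasCompactSupport.of_compactSpace f)

lemma continuous_evalR3_coe (p : MvPolynomial (Fin 3) ℝ) :
    Continuous fun x : S2 => evalR3 p x :=
  (continuous_evalR3 p).comp continuous_subtype_val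

lemma integral_evalR3_mul_gaussian {p : MvPolynomial (Fin 3) ℝ} {d : ℕ} (hp : p.IsHomogeneous d) :
    Integrable (fun x : R3 => evalR3 p x * Real.exp (-‖x‖ ^ 2)) ∧
      ∫ x : R3, evalR3 p x * Real.exp (-‖x‖ ^ 2) = (∫ y : S2, evalR3 p y ∂surf) * gaussMoment d := by
  refine integral_polar (f := fun y : S2 => evalR3 p y) (g := fun r => r ^ d * Real.exp (-r ^ 2))
    (fun y r hr => ?_) (integrable_of_continuous (continuous_evalR3_coe p))
    (integrableOn_gaussMoment d)
  rw [evalR3_smul hp, norm_smul, norm_eq_of_mem_sphere, mul_one, Real.norm_eq_abs, sq_abs]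
  ring

/-- Integration by parts on the sphere for homogeneous polynomials. It comes from integrating
`∂_i (q e^{-|x|²})` over `ℝ³` in polar coordinates. -/
lemma integral_pderiv {q : MvPolynomial (Fin 3) ℝ} {d : ℕ} (hq : q.IsHomogeneous d) (i : Fin 3) :
    ∫ y : S2, evalR3 (MvPolynomial.pderiv i q) y ∂surf =
      ((d : ℝ) + 2) * ∫ y : S2, evalR3 (MvPolynomial.X i * q) y ∂surf := by
  have hXq : (MvPolynomial.X i * q).IsHomogeneous (d + 1) := by
    rw [add_comm]
    exact (MvPolynomial.isHomogeneous_X ℝ i).mul hq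
  have h1 := integral_evalR3_mul_gaussian hq
  have h2 := integral_evalR3_mul_gaussian (hq.pderiv (i := i))
  have h3 := integral_evalR3_mul_gaussian hXq
  set v : R3 := EuclideanSpace.single i 1 with hv
  have hw : ∀ x : R3, HasFDerivAt (fun x : R3 => Real.exp (-‖x‖ ^ 2))
      (Real.exp (-‖x‖ ^ 2) • -((2 : ℕ) • (innerSL ℝ x : R3 →L[ℝ] ℝ))) x := fun x =>
    ((hasStrictFDerivAt_norm_sq x).hasFDerivAt.fun_neg).exp
  have e1 : ∀ x : R3, fderiv ℝ (evalR3 q) x v = evalR3 (MvPolynomial.pderiv i q) x := fun x => by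
    rw [(hasFDerivAt_evalR3 q x).fderiv, innerSL_apply_apply, hv, EuclideanSpace.inner_single_right]
    simp
  have e2 : ∀ x : R3, evalR3 q x * fderiv ℝ (fun x : R3 => Real.exp (-‖x‖ ^ 2)) x v =
      -2 * (evalR3 (MvPolynomial.X i * q) x * Real.exp (-‖x‖ ^ 2)) := fun x => by
    rw [(hw x).fderiv, hv]
    simp [EuclideanSpace.inner_single_right]
    ring
  have hparts := integral_mul_fderiv_eq_neg_fderiv_mul_of_integrable (μ := (volume : Measure R3))
    (f := evalR3 q) (g := fun x : R3 => Real.exp (-‖x‖ ^ 2)) (v := v)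
    (by simpa only [e1] using h2.1) (by simpa only [e2] using h3.1.const_mul (-2)) h1.1
    (fun x _ => (hasFDerivAt_evalR3 q x).differentiableAt) (fun x _ => (hw x).differentiableAt)
  simp only [e1, e2] at hparts
  rw [integral_const_mul, h2.2, h3.2] at hparts
  rcases d with _ | e
  · have h0 : MvPolynomial.pderiv i q = 0 := by
      rw [MvPolynomial.totalDegree_eq_zero_iff_eq_C.mp (Nat.le_zero.mp hq.totalDegree_le),
        MvPolynomial.pderiv_C]
    have h00 : ∀ y : S2, evalR3 (MvPolynomial.pderiv i q) y = 0 := fun y => by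
      rw [h0]; exact map_zero _
    have := (gaussMoment_pos 1).ne'
    simp only [h00, integral_zero, zero_mul, neg_zero, mul_eq_zero, zero_add, this, or_false] at hparts ⊢
    norm_num at hparts
    simp [hparts]
  · have hG := gaussMoment_pos e
    rw [gaussMoment_add_two, Nat.add_sub_cancel] at hparts
    refine mul_right_cancel₀ hG.ne' ?_
    push_cast
    linarith

/-! ### Surface gradients -/

lemma cross3_apply (u v : R3) : cross3 u v =
    !₂[u 1 * v 2 - u 2 * v 1, u 2 * v 0 - u 0 * v 2, u 0 * v 1 - u 1 * v 0] := by
  rw [cross3, cross_apply]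

lemma inner_R3 (u v : R3) : inner ℝ u v = u 0 * v 0 + u 1 * v 1 + u 2 * v 2 := by
  rw [PiLp.inner_apply, Fin.sum_univ_three]
  simp [mul_comm]

lemma sphere_sq_sum (x : S2) : (x : R3) 0 ^ 2 + (x : R3) 1 ^ 2 + (x : R3) 2 ^ 2 = 1 := by
  have h := real_inner_self_eq_norm_sq (x : R3)
  rw [norm_eq_of_mem_sphere, inner_R3] at h
  linarith

lemma inner_cross3_cross3 (x : S2) (u v : R3) : inner ℝ (cross3 x u) (cross3 x v) =
    inner ℝ u v - inner ℝ (x : R3) u * inner ℝ (x : R3) v := by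
  have h := sphere_sq_sum x
  simp only [inner_R3, cross3_apply]
  simp
  linear_combination (u 0 * v 0 + u 1 * v 1 + u 2 * v 2) * h

lemma cross3_sub_smul_self (x : S2) (u : R3) (c : ℝ) :
    cross3 x (u - c • (x : R3)) = cross3 x u := by
  simp only [cross3_apply]
  ext i
  fin_cases i <;> simp <;> ring

lemma inner_cross3_self (x u : R3) : inner ℝ (cross3 x u) x = 0 := by
  simp only [inner_R3, cross3_apply]
  simp
  ring

/-- The derivative at a unit vector of the radial projection is the tangential projection. -/
lemma hasFDerivAt_normalize (x : S2) :
    HasFDerivAt (fun y : R3 => ‖y‖⁻¹ • y)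
      (ContinuousLinearMap.id ℝ R3 - (innerSL ℝ (x : R3)).smulRight (x : R3)) (x : R3) := by
  have hx : ‖(x : R3)‖ = 1 := norm_eq_of_mem_sphere x
  have h1 : HasFDerivAt (fun y : R3 => ‖y‖) (innerSL ℝ (x : R3)) (x : R3) := by
    have h := ((hasStrictFDerivAt_norm_sq (x : R3)).hasFDerivAt).sqrt (by rw [hx]; norm_num)
    refine (h.congr_fderiv ?_).congr_of_eventuallyEq (Eventually.of_forall fun y => ?_)
    · ext v
      simp [hx]
    · simp [Real.sqrt_sq (norm_nonneg y)]
  have h2 := ((hasDerivAt_inv (x := ‖(x : R3)‖) (by rw [hx]; exact one_ne_zero)).comp_hasFDerivAt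
    (x : R3) h1).fun_smul (hasFDerivAt_id (x : R3))
  refine h2.congr_fderiv ?_
  ext v i
  simp [hx]
  ring

lemma radialExt_eventuallyEq (f : R3 → ℝ) (x : S2) :
    radialExt (fun y : S2 => f y) =ᶠ[𝓝 (x : R3)] fun y => f (‖y‖⁻¹ • y) := by
  have h0 : (x : R3) ≠ 0 := ne_zero_of_mem_unit_sphere x
  filter_upwards [isOpen_ne.mem_nhds h0] with y hy
  rw [radialExt, dif_neg hy]

/-- The surface gradient of the restriction of a polynomial is the tangential part of its
gradient. -/
lemma sphereGrad_evalR3 (p : MvPolynomial (Fin 3) ℝ) (x : S2) :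
    sphereGrad (fun y : S2 => evalR3 p y) x =
      polyGrad p x - inner ℝ (x : R3) (polyGrad p x) • (x : R3) := by
  have hx : ‖(x : R3)‖ = 1 := norm_eq_of_mem_sphere x
  have hx' : ‖(x : R3)‖⁻¹ • (x : R3) = x := by rw [hx, inv_one, one_smul]
  have hp : HasFDerivAt (evalR3 p) (innerSL ℝ (polyGrad p x)) (‖(x : R3)‖⁻¹ • (x : R3)) := by
    rw [hx']; exact hasFDerivAt_evalR3 p x
  have h := (hp.comp (f := fun y : R3 => ‖y‖⁻¹ • y) (x : R3) (hasFDerivAt_normalize x)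
    ).congr_of_eventuallyEq (radialExt_eventuallyEq (evalR3 p) x)
  refine HasGradientAt.gradient (hasGradientAt_iff_hasFDerivAt.mpr (h.congr_fderiv ?_))
  ext v
  simp [real_inner_comm]
  ring

lemma skewGrad_evalR3 (p : MvPolynomial (Fin 3) ℝ) (x : S2) :
    skewGrad (fun y : S2 => evalR3 p y) x = cross3 x (polyGrad p x) := by
  rw [skewGrad, sphereGrad_evalR3, cross3_sub_smul_self]

lemma bracket_evalR3 (p q : MvPolynomial (Fin 3) ℝ) (x : S2) :
    bracket (fun y : S2 => evalR3 p y) (fun y : S2 => evalR3 q y) x =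
      inner ℝ (cross3 x (polyGrad p x)) (polyGrad q x) := by
  rw [bracket, skewGrad_evalR3, sphereGrad_evalR3, inner_sub_right, inner_smul_right,
    inner_cross3_self, mul_zero, sub_zero]

lemma continuous_polyGrad (p : MvPolynomial (Fin 3) ℝ) : Continuous (polyGrad p) :=
  (PiLp.continuous_toLp 2 _).comp
    (continuous_pi fun i => continuous_evalR3 (MvPolynomial.pderiv i p))

lemma continuous_cross3 : Continuous fun z : R3 × R3 => cross3 z.1 z.2 := by
  simp only [cross3_apply]
  refine (PiLp.continuous_toLp 2 _).comp (continuous_pi fun i => ?_)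
  fin_cases i <;> simp <;> fun_prop

lemma continuous_skewGrad_evalR3 (p : MvPolynomial (Fin 3) ℝ) :
    Continuous (skewGrad fun y : S2 => evalR3 p y) := by
  have : (skewGrad fun y : S2 => evalR3 p y) = fun x : S2 => cross3 x (polyGrad p x) :=
    funext (skewGrad_evalR3 p)
  rw [this]
  exact continuous_cross3.comp
    (continuous_subtype_val.prodMk ((continuous_polyGrad p).comp continuous_subtype_val))

lemma smoothOnSphere_evalR3 (p : MvPolynomial (Fin 3) ℝ) :
    SmoothOnSphere fun y : S2 => evalR3 p y := by
  have h1 : ContDiff ℝ ((⊤ : ℕ∞) : WithTop ℕ∞) (evalR3 p) := by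
    induction p using MvPolynomial.induction_on with
    | C c =>
      rw [show evalR3 (MvPolynomial.C c) = fun _ => c from funext (evalR3_C c)]
      exact contDiff_const
    | add p q hp hq =>
      rw [show evalR3 (p + q) = fun x => evalR3 p x + evalR3 q x from funext (evalR3_add p q)]
      exact hp.add hq
    | mul_X p j hp =>
      rw [show evalR3 (p * MvPolynomial.X j) = fun x => evalR3 p x * x j from
        funext fun x => by simp]
      exact hp.mul (EuclideanSpace.proj j : R3 →L[ℝ] ℝ).contDiff
  exact h1.contMDiff.comp contMDiff_coe_sphere

/-- The extension of a smooth function that is constant along rays is smooth off the origin. -/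
lemma contDiffAt_radialExt {φ : S2 → ℝ} (hφ : SmoothOnSphere φ) {x : R3} (hx : x ≠ 0) :
    ContDiffAt ℝ ((⊤ : ℕ∞) : WithTop ℕ∞) (radialExt φ) x := by
  let U : TopologicalSpace.Opens R3 := ⟨{0}ᶜ, isOpen_compl_singleton⟩
  have hU : ∀ y : U, (y : R3) ≠ 0 := fun y => y.2
  have hn : ContMDiff 𝓘(ℝ, R3) 𝓘(ℝ, R3) ((⊤ : ℕ∞) : WithTop ℕ∞)
      (fun y : U => ‖(y : R3)‖⁻¹ • (y : R3)) := by
    intro y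
    refine (contMDiffAt_subtype_iff (f := fun y : R3 => ‖y‖⁻¹ • y)).mpr ?_
    refine ContDiffAt.contMDiffAt ?_
    exact (((contDiffAt_norm ℝ (hU y)).inv (norm_ne_zero_iff.mpr (hU y)))).smul contDiffAt_id
  have hs : ∀ y : U, ‖(y : R3)‖⁻¹ • (y : R3) ∈ Metric.sphere (0 : R3) 1 := fun y => by
    rw [mem_sphere_zero_iff_norm, norm_smul, norm_inv, norm_norm]
    exact inv_mul_cancel₀ (norm_ne_zero_iff.mpr (hU y))
  have h := hφ.comp (hn.codRestrict_sphere (n := 2) hs)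
  have e : (φ ∘ codRestrict _ _ hs) = fun y : U => radialExt φ y := by
    ext y
    rw [radialExt, dif_neg (hU y)]
    rfl
  rw [e] at h
  exact contMDiffAt_iff_contDiffAt.mp (contMDiffAt_subtype_iff.mp (h ⟨x, hx⟩))

lemma continuous_sphereGrad {φ : S2 → ℝ} (hφ : SmoothOnSphere φ) : Continuous (sphereGrad φ) := by
  refine continuous_iff_continuousAt.mpr fun x => ?_
  have h := (contDiffAt_radialExt hφ (ne_zero_of_mem_unit_sphere x)).fderiv_right
    (m := 0) (by exact_mod_cast le_top)
  have h2 : ContinuousAt (∇ (radialExt φ)) (x : R3) :=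
    (InnerProductSpace.toDual ℝ R3).symm.continuous.continuousAt.comp h.continuousAt
  exact h2.comp continuous_subtype_val.continuousAt

lemma norm_sphereGrad_le_gradSup {φ : S2 → ℝ} (hφ : SmoothOnSphere φ) (x : S2) :
    ‖sphereGrad φ x‖ ≤ gradSup φ :=
  le_ciSup (f := fun x => ‖sphereGrad φ x‖)
    (isCompact_range (continuous_sphereGrad hφ).norm).bddAbove x

/-! ### Orthogonality of the noise fields -/

section Laplacian

open MvPolynomial

/-- The Laplacian of a polynomial in three variables. -/
noncomputable def polyLaplacian (p : MvPolynomial (Fin 3) ℝ) : MvPolynomial (Fin 3) ℝ :=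
  ∑ i : Fin 3, pderiv i (pderiv i p)

lemma pderiv_comm (i j : Fin 3) (p : MvPolynomial (Fin 3) ℝ) :
    pderiv i (pderiv j p) = pderiv j (pderiv i p) := by
  have h : ⁅(pderiv i : Derivation ℝ (MvPolynomial (Fin 3) ℝ) _), pderiv j⁆ = 0 :=
    derivation_ext fun k => by
      rw [Derivation.commutator_apply, pderiv_X, pderiv_X, Pi.single_apply, Pi.single_apply]
      split_ifs <;> simp
  have := DFunLike.congr_fun h p
  rwa [Derivation.commutator_apply, Derivation.zero_apply, sub_eq_zero] at this

/-- On homogeneous functions of degree `n` the Laplacian of `ℝ³` and the factor `n(n+1)` differ on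
the sphere by the Laplace–Beltrami operator, whose integral vanishes. -/
lemma integral_polyLaplacian {h : MvPolynomial (Fin 3) ℝ} {n : ℕ} (hh : h.IsHomogeneous n) :
    ∫ y : S2, evalR3 (polyLaplacian h) y ∂surf = (n : ℝ) * (n + 1) * ∫ y : S2, evalR3 h y ∂surf := by
  have hsum : ∀ (q : Fin 3 → MvPolynomial (Fin 3) ℝ), ∫ y : S2, evalR3 (∑ i, q i) y ∂surf =
      ∑ i, ∫ y : S2, evalR3 (q i) y ∂surf := by
    intro q
    rw [← integral_finsetSum _ fun i _ => integrable_of_continuous (continuous_evalR3_coe (q i))]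
    simp [evalR3]
  rcases n with _ | n
  · have h0 : polyLaplacian h = 0 := by
      rw [totalDegree_eq_zero_iff_eq_C.mp (Nat.le_zero.mp hh.totalDegree_le)]
      simp [polyLaplacian]
    rw [h0]
    simp [evalR3]
  · have hE : ∫ y : S2, evalR3 (∑ i, X i * pderiv i h) y ∂surf =
        ((n + 1 : ℕ) : ℝ) * ∫ y : S2, evalR3 h y ∂surf := by
      rw [hh.sum_X_mul_pderiv, ← integral_const_mul]
      simp [evalR3]
    rw [polyLaplacian, hsum, Finset.sum_congr rfl fun i _ =>
      integral_pderiv (hh.pderiv (i := i)) i, ← Finset.mul_sum, ← hsum, hE]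
    push_cast
    ring

lemma polyLaplacian_mul (p q : MvPolynomial (Fin 3) ℝ) : polyLaplacian (p * q) =
    polyLaplacian p * q + p * polyLaplacian q + 2 * ∑ i, pderiv i p * pderiv i q := by
  simp only [polyLaplacian, Fin.sum_univ_three, Derivation.leibniz, map_add, smul_eq_mul]
  ring

lemma inner_self_polyGrad {p : MvPolynomial (Fin 3) ℝ} {l : ℕ} (hp : p.IsHomogeneous l) (x : R3) :
    inner ℝ x (polyGrad p x) = l * evalR3 p x := by
  have := congrArg (fun q => evalR3 q x) hp.sum_X_mul_pderiv
  simp only [Fin.sum_univ_three, evalR3_add, evalR3_mul, evalR3_X] at this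
  rw [inner_R3]
  simp only [polyGrad_apply, this]
  simp [evalR3]

/-- Green's formula for spherical harmonics: the pairing of two skew gradients. -/
lemma integral_inner_skewGrad {p q : MvPolynomial (Fin 3) ℝ} {l k : ℕ} (hp : p.IsHomogeneous l)
    (hq : q.IsHomogeneous k) (hp0 : polyLaplacian p = 0) (hq0 : polyLaplacian q = 0) :
    ∫ x, inner ℝ (skewGrad (fun y : S2 => evalR3 p y) x) (skewGrad (fun y : S2 => evalR3 q y) x)
      ∂surf = ((l : ℝ) * (l + 1) + k * (k + 1)) / 2 * ∫ x : S2, evalR3 p x * evalR3 q x ∂surf := by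
  have hpq := integral_polyLaplacian (hp.mul hq)
  have e : ∀ x : S2, inner ℝ (skewGrad (fun y : S2 => evalR3 p y) x)
      (skewGrad (fun y : S2 => evalR3 q y) x) =
      1 / 2 * evalR3 (polyLaplacian (p * q)) x - (l : ℝ) * k * evalR3 (p * q) x := by
    intro x
    have h2 : evalR3 2 x = 2 := by simp [evalR3]
    rw [skewGrad_evalR3, skewGrad_evalR3, inner_cross3_cross3, inner_self_polyGrad hp,
      inner_self_polyGrad hq, polyLaplacian_mul, hp0, hq0, inner_R3]
    simp only [zero_mul, mul_zero, zero_add, Fin.sum_univ_three, evalR3_add, evalR3_mul,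
      polyGrad_apply, h2]
    ring
  simp_rw [e]
  rw [integral_sub, integral_const_mul, integral_const_mul, hpq]
  · simp only [evalR3_mul]
    push_cast
    ring
  · exact (integrable_of_continuous (continuous_evalR3_coe _)).const_mul _
  · exact (integrable_of_continuous (continuous_evalR3_coe _)).const_mul _

end Laplacian

/-! ### Bessel's inequality for the noise fields -/

lemma continuous_skewGrad_of_harmonic {Y : Mode → S2 → ℝ} (hY : IsHarmonicSystem Y) (i : Mode) :
    Continuous (skewGrad (Y i)) := by
  obtain ⟨p, _, _, h⟩ := hY.harmonic i
  rw [show Y i = fun y : S2 => evalR3 p y from funext h]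
  exact continuous_skewGrad_evalR3 p

lemma memLp_of_continuous {f : S2 → ℝ} (hf : Continuous f) : MemLp f 2 surf :=
  hf.memLp_of_hasCompactSupport (HasCompactSupport.of_compactSpace f)

lemma pair_eq_inner {f : S2 → ℝ} (hf : MemLp f 2 surf) (u : L2S) :
    pair f u = inner ℝ (hf.toLp f) u := by
  rw [pair, L2.inner_def]
  refine integral_congr_ae ?_
  filter_upwards [hf.coeFn_toLp] with x h1
  rw [h1]
  simp [mul_comm]

/-- Bessel's inequality for an orthogonal family of vectors of norm at most `|A|`, some of which may
vanish. -/
lemma sum_sq_inner_le_of_orthogonal {E ι : Type*} [NormedAddCommGroup E] [InnerProductSpace ℝ E]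
    (s : Finset ι) (v : ι → E) (hv : ∀ i j, i ≠ j → inner ℝ (v i) (v j) = 0) {A : ℝ}
    (hA : ∀ i, ‖v i‖ ^ 2 ≤ A ^ 2) (F : E) :
    ∑ i ∈ s, inner ℝ (v i) F ^ 2 ≤ A ^ 2 * ‖F‖ ^ 2 := by
  classical
  set S := ∑ i ∈ s, inner ℝ (v i) F ^ 2 with hS
  set w := ∑ i ∈ s, inner ℝ (v i) F • v i with hw
  have hS0 : 0 ≤ S := Finset.sum_nonneg fun i _ => sq_nonneg _
  have h1 : inner ℝ w F = S := by
    rw [hw, sum_inner, hS]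
    refine Finset.sum_congr rfl fun i _ => ?_
    rw [real_inner_smul_left, sq]
  have h2 : ‖w‖ ^ 2 ≤ A ^ 2 * S := by
    rw [← real_inner_self_eq_norm_sq]
    nth_rewrite 1 [hw]
    rw [sum_inner, hS, Finset.mul_sum]
    refine Finset.sum_le_sum fun i hi => ?_
    rw [hw, inner_sum, Finset.sum_eq_single_of_mem i hi]
    · rw [real_inner_smul_left, real_inner_smul_right, real_inner_self_eq_norm_sq]
      nlinarith [hA i, sq_nonneg (inner ℝ (v i) F)]
    · intro j _ hji
      rw [real_inner_smul_left, real_inner_smul_right, hv i j hji.symm, mul_zero, mul_zero]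
  have h3 : S ^ 2 ≤ S * (A ^ 2 * ‖F‖ ^ 2) := by
    have := real_inner_mul_inner_self_le w F
    rw [h1, real_inner_self_eq_norm_sq, real_inner_self_eq_norm_sq] at this
    nlinarith [sq_nonneg ‖F‖]
  rcases hS0.eq_or_lt with h0 | h0
  · rw [← h0]; positivity
  · rw [sq] at h3
    exact le_of_mul_le_mul_left h3 h0

/-- If the fields `α_i ∇^⊥ Y_i` have norm at most `A`, the coefficients of `u ∇φ` in this orthogonal
system are square summable with the bound `A² ‖u ∇φ‖² ≤ A² ‖∇φ‖_∞² ‖u‖²`. -/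
lemma sum_sq_pair_bracket_le {Y : Mode → S2 → ℝ} (hY : IsHarmonicSystem Y) {α : Mode → ℝ} {A : ℝ}
    (hA : ∀ i, α i ^ 2 * ∫ x, ‖skewGrad (Y i) x‖ ^ 2 ∂surf ≤ A ^ 2) {φ : S2 → ℝ}
    (hφ : SmoothOnSphere φ) (u : L2S) (s : Finset Mode) :
    ∑ i ∈ s, pair (fun x => α i * bracket (Y i) φ x) u ^ 2 ≤
      A ^ 2 * gradSup φ ^ 2 * ‖u‖ ^ 2 := by
  have hV : ∀ i, MemLp (fun x => α i • skewGrad (Y i) x) 2 surf := fun i =>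
    ((continuous_skewGrad_of_harmonic hY i).const_smul (α i)).memLp_of_hasCompactSupport
      (HasCompactSupport.of_compactSpace _)
  have hFle : ∀ x, ‖u x • sphereGrad φ x‖ ≤ gradSup φ * ‖u x‖ := fun x => by
    rw [norm_smul, mul_comm]
    exact mul_le_mul_of_nonneg_right (norm_sphereGrad_le_gradSup hφ x) (norm_nonneg _)
  have hF : MemLp (fun x => u x • sphereGrad φ x) 2 surf :=
    (Lp.memLp u).of_le_mul ((Lp.aestronglyMeasurable u).smul
      (continuous_sphereGrad hφ).aestronglyMeasurable) (Eventually.of_forall hFle)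
  have hinner : ∀ (f g : S2 → R3) (hf : MemLp f 2 surf) (hg : MemLp g 2 surf),
      inner ℝ (hf.toLp f) (hg.toLp g) = ∫ x, inner ℝ (f x) (g x) ∂surf := fun f g hf hg => by
    rw [L2.inner_def]
    refine integral_congr_ae ?_
    filter_upwards [hf.coeFn_toLp, hg.coeFn_toLp] with x h1 h2
    rw [h1, h2]
  have h1 : ∀ i, pair (fun x => α i * bracket (Y i) φ x) u =
      inner ℝ ((hV i).toLp _) (hF.toLp _) := fun i => by
    rw [hinner, pair]
    refine integral_congr_ae (Eventually.of_forall fun x => ?_)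
    simp only [bracket, real_inner_smul_left, real_inner_smul_right]
    ring
  simp_rw [h1]
  have h2 : ‖hF.toLp _‖ ≤ gradSup φ * ‖u‖ := by
    refine Lp.norm_le_mul_norm_of_ae_le_mul ?_
    filter_upwards [hF.coeFn_toLp] with x hx
    rw [hx]
    exact hFle x
  refine (sum_sq_inner_le_of_orthogonal s (fun i => (hV i).toLp _) ?_ (A := A) ?_ _).trans ?_
  · intro i j hij
    obtain ⟨p, hp, hp0, hpe⟩ := hY.harmonic i
    obtain ⟨q, hq, hq0, hqe⟩ := hY.harmonic j
    have hpi : Y i = fun y : S2 => evalR3 p y := funext hpe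
    have hqj : Y j = fun y : S2 => evalR3 q y := funext hqe
    have ho := hY.orthogonal i j hij
    have hg := integral_inner_skewGrad hp hq hp0 hq0
    rw [← hpi, ← hqj] at hg
    rw [hinner]
    simp only [real_inner_smul_left, real_inner_smul_right]
    rw [integral_const_mul, integral_const_mul, hg]
    have : ∫ x : S2, evalR3 p x * evalR3 q x ∂surf = 0 := by
      rw [← ho, hpi, hqj]
    rw [this]
    simp
  · intro i
    refine le_trans (le_of_eq ?_) (hA i)
    rw [← real_inner_self_eq_norm_sq, hinner, ← integral_const_mul]
    refine integral_congr_ae (Eventually.of_forall fun x => ?_)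
    simp only
    rw [real_inner_self_eq_norm_sq, norm_smul, mul_pow, Real.norm_eq_abs, sq_abs]
  · calc A ^ 2 * ‖hF.toLp _‖ ^ 2 ≤ A ^ 2 * (gradSup φ * ‖u‖) ^ 2 := by gcongr
      _ = _ := by ring

/-- Under either normalisation the fields `α^M_{ℓ,m} ∇^⊥ Y_{ℓ,m}` have norm at most
`‖α^M‖_{ℓ^∞}`; for `L²`-normalised `Y` the norm `√(ℓ(ℓ+1))` of `∇^⊥ Y` is absorbed by the decay
`(ℓ+1)^{-a}` of the coefficients. -/
lemma noiseAlpha_sq_mul_le {ν a : ℝ} (ha : 0 ≤ a) {Y : Mode → S2 → ℝ} (hY : IsHarmonicSystem Y)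
    (hN : (∀ i : Mode, 1 ≤ i.1 → ∫ x, ‖skewGrad (Y i) x‖ ^ 2 ∂surf = 1) ∨
        (1 ≤ a ∧ ∀ i : Mode, 1 ≤ i.1 → ∫ x, Y i x ^ 2 ∂surf = 1)) (M : ℕ) (i : Mode) :
    noiseAlpha ν a M i ^ 2 * ∫ x, ‖skewGrad (Y i) x‖ ^ 2 ∂surf ≤
      normSup (noiseAlpha ν a M) ^ 2 := by
  have hgreen : ∫ x, ‖skewGrad (Y i) x‖ ^ 2 ∂surf =
      (i.1 : ℝ) * (i.1 + 1) * ∫ x, Y i x ^ 2 ∂surf := by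
    obtain ⟨p, hp, hp0, hpe⟩ := hY.harmonic i
    have hpi : Y i = fun y : S2 => evalR3 p y := funext hpe
    have hg := integral_inner_skewGrad hp hp hp0 hp0
    rw [← hpi] at hg
    simp only [real_inner_self_eq_norm_sq] at hg
    rw [hg, hpi]
    simp only [sq]
    ring
  set K := √(2 * ν) / normTwo (noiseC a M) with hK
  have hsup : normSup (noiseAlpha ν a M) = K := by rw [normSup_noiseAlpha ν ha, hK, div_eq_mul_inv]
  have hc0 := noiseC_nonneg a M i
  have hc1 := noiseC_le_one ha M i
  rw [hsup, noiseAlpha, mul_pow, mul_assoc]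
  refine mul_le_of_le_one_right (sq_nonneg K) ?_
  rcases Nat.eq_zero_or_pos i.1 with h0 | h0
  · rw [hgreen, h0]
    simp
  rcases hN with h | ⟨ha1, h⟩
  · rw [h i h0, mul_one]
    exact pow_le_one₀ hc0 hc1
  · rw [hgreen, h i h0, mul_one]
    have hl : (1 : ℝ) ≤ (i.1 : ℝ) + 1 := by simp
    have h2 : noiseC a M i ≤ 1 / ((i.1 : ℝ) + 1) := by
      unfold noiseC
      split_ifs
      · gcongr
        exact Real.self_le_rpow_of_one_le hl ha1
      · positivity
    calc noiseC a M i ^ 2 * ((i.1 : ℝ) * (i.1 + 1))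
        ≤ (1 / ((i.1 : ℝ) + 1)) ^ 2 * (((i.1 : ℝ) + 1) * (i.1 + 1)) := by
          gcongr
          linarith
      _ = 1 := by field_simp

/-! ### Functions annihilated by all rotations -/

section Rotations

open MvPolynomial

/-- The derivative of a polynomial along the rotation about the `j`-th coordinate axis. -/
noncomputable def angMom (j : Fin 3) (p : MvPolynomial (Fin 3) ℝ) : MvPolynomial (Fin 3) ℝ :=
  X (j + 2) * pderiv (j + 1) p - X (j + 1) * pderiv (j + 2) p

/-- The Poisson bracket of polynomials. -/
noncomputable def polyBracket (p q : MvPolynomial (Fin 3) ℝ) : MvPolynomial (Fin 3) ℝ :=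
  ∑ j, pderiv j p * angMom j q

lemma bracket_eq_polyBracket (p q : MvPolynomial (Fin 3) ℝ) (x : S2) :
    bracket (fun y : S2 => evalR3 p y) (fun y : S2 => evalR3 q y) x = evalR3 (polyBracket p q) x := by
  have h2 : (1 : Fin 3) + 1 = 2 := rfl
  have h3 : (1 : Fin 3) + 2 = 0 := rfl
  have h4 : (2 : Fin 3) + 1 = 0 := rfl
  have h5 : (2 : Fin 3) + 2 = 1 := rfl
  rw [bracket_evalR3, inner_R3, cross3_apply, polyBracket]
  simp only [Fin.sum_univ_three, angMom, zero_add, h2, h3, h4, h5, evalR3_add, evalR3_mul,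
    evalR3_sub, evalR3_X, polyGrad_apply]
  simp
  ring

/-- The squares of the rotation derivatives add up to the Laplace–Beltrami operator. -/
lemma sum_angMom_angMom (p : MvPolynomial (Fin 3) ℝ) :
    ∑ j, angMom j (angMom j p) = (∑ i, X i ^ 2) * polyLaplacian p -
      (∑ i, X i * pderiv i (∑ k, X k * pderiv k p) + ∑ i, X i * pderiv i p) := by
  have h2 : (1 : Fin 3) + 1 = 2 := rfl
  have h3 : (1 : Fin 3) + 2 = 0 := rfl
  have h4 : (2 : Fin 3) + 1 = 0 := rfl
  have h5 : (2 : Fin 3) + 2 = 1 := rfl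
  simp only [Fin.sum_univ_three, angMom, polyLaplacian, zero_add, h2, h3, h4, h5, map_sub, map_add,
    Derivation.leibniz, smul_eq_mul, pderiv_X, pderiv_comm 1 0, pderiv_comm 2 0, pderiv_comm 2 1]
  simp
  ring

/-- Integration of polynomials against `u ∈ L²(S²)`. -/
noncomputable def polyPair (u : L2S) : MvPolynomial (Fin 3) ℝ →ₗ[ℝ] ℝ where
  toFun p := pair (fun x : S2 => evalR3 p x) u
  map_add' p q := by
    rw [pair_eq_inner (memLp_of_continuous (continuous_evalR3_coe p)),
      pair_eq_inner (memLp_of_continuous (continuous_evalR3_coe q)), ← inner_add_left,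
      ← MemLp.toLp_add, ← pair_eq_inner]
    simp [Pi.add_def]
  map_smul' c p := by
    simp only [pair, RingHom.id_apply, smul_eq_mul]
    rw [← integral_const_mul]
    simp [evalR3, mul_assoc]

lemma polyPair_apply (u : L2S) (p : MvPolynomial (Fin 3) ℝ) :
    polyPair u p = pair (fun x : S2 => evalR3 p x) u := rfl

lemma isHomogeneous_polyLaplacian {p : MvPolynomial (Fin 3) ℝ} {n : ℕ} (hp : p.IsHomogeneous n) :
    (polyLaplacian p).IsHomogeneous (n - 1 - 1) :=
  IsHomogeneous.sum _ _ _ fun _ _ => hp.pderiv.pderiv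

/-- If all rotation derivatives are orthogonal to `u`, then
`n(n+1) ⟨p, u⟩ = ⟨Δp, u⟩` for homogeneous polynomials `p` of degree `n`. -/
lemma polyPair_polyLaplacian {u : L2S} (hu : ∀ j q, polyPair u (angMom j q) = 0)
    {p : MvPolynomial (Fin 3) ℝ} {n : ℕ} (hp : p.IsHomogeneous n) :
    polyPair u (polyLaplacian p) = (n : ℝ) * (n + 1) * polyPair u p := by
  have h1 : polyPair u (∑ j, angMom j (angMom j p)) = 0 := by
    rw [map_sum]
    exact Finset.sum_eq_zero fun j _ => hu j _
  have h2 : polyPair u ((∑ i, X i ^ 2) * polyLaplacian p) = polyPair u (polyLaplacian p) := by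
    rw [polyPair_apply, polyPair_apply]
    congr 1
    ext x
    have := sphere_sq_sum x
    simp only [Fin.sum_univ_three, evalR3_mul, evalR3_add, sq, evalR3_X] at this ⊢
    rw [this, one_mul]
  rw [sum_angMom_angMom, hp.sum_X_mul_pderiv, map_sub, h2] at h1
  simp only [map_nsmul, mul_smul_comm, ← Finset.smul_sum, hp.sum_X_mul_pderiv, map_add] at h1
  simp only [nsmul_eq_mul] at h1
  linarith

lemma surf_univ_pos : 0 < surf.real univ := by
  have : surf ≠ 0 := Measure.toSphere_ne_zero _
  have := Measure.measure_univ_ne_zero.mpr this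
  exact ENNReal.toReal_pos this (measure_ne_top _ _)

/-- A functional on polynomials that satisfies the recursion of the surface integral is a multiple
of it. -/
lemma polyPair_eq_const_mul_integral {u : L2S} (hu : ∀ j q, polyPair u (angMom j q) = 0)
    (p : MvPolynomial (Fin 3) ℝ) :
    polyPair u p = polyPair u 1 / surf.real univ * ∫ x : S2, evalR3 p x ∂surf := by
  have hhom : ∀ n : ℕ, ∀ p : MvPolynomial (Fin 3) ℝ, p.IsHomogeneous n →
      polyPair u p = polyPair u 1 / surf.real univ * ∫ x : S2, evalR3 p x ∂surf := by
    intro n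
    induction n using Nat.strong_induction_on with
    | _ n ih =>
      intro p hp
      rcases Nat.eq_zero_or_pos n with rfl | hn
      · have hC := totalDegree_eq_zero_iff_eq_C.mp (Nat.le_zero.mp hp.totalDegree_le)
        have h1 : polyPair u p = coeff 0 p * polyPair u 1 := by
          rw [← smul_eq_mul, ← map_smul, smul_eq_C_mul, mul_one, ← hC]
        have h2 : ∀ x : S2, evalR3 p x = coeff 0 p := fun x => by
          rw [hC, evalR3_C, coeff_zero_C]
        simp_rw [h1, h2]
        rw [integral_const, smul_eq_mul]
        field_simp [surf_univ_pos.ne']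
      · have h1 := ih (n - 1 - 1) (by omega) _ (isHomogeneous_polyLaplacian hp)
        rw [polyPair_polyLaplacian hu hp, integral_polyLaplacian hp] at h1
        have hn' : (n : ℝ) * (n + 1) ≠ 0 := by positivity
        refine mul_left_cancel₀ hn' ?_
        linarith
  rw [← sum_homogeneousComponent p, map_sum]
  have hsum : ∫ x : S2, evalR3 (∑ i ∈ Finset.range (p.totalDegree + 1), homogeneousComponent i p) x
      ∂surf = ∑ i ∈ Finset.range (p.totalDegree + 1),
        ∫ x : S2, evalR3 (homogeneousComponent i p) x ∂surf := by
    rw [← integral_finsetSum _ fun i _ => integrable_of_continuous (continuous_evalR3_coe _)]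
    simp [evalR3]
  rw [hsum, Finset.mul_sum]
  exact Finset.sum_congr rfl fun i _ => hhom i _ (homogeneousComponent_isHomogeneous i p)

/-- Polynomials are dense in `L²(S²)`. -/
lemma eq_zero_of_polyPair_eq_zero {w : L2S} (hw : ∀ p, polyPair w p = 0) : w = 0 := by
  let Φ : MvPolynomial (Fin 3) ℝ →ₐ[ℝ] C(S2, ℝ) :=
    aeval fun i => ⟨fun x : S2 => (x : R3) i, by fun_prop⟩
  have hΦ : ∀ p (x : S2), Φ p x = evalR3 p x := by
    intro p x
    have : ((ContinuousMap.evalAlgHom ℝ ℝ x).comp Φ) = aeval (x : R3).ofLp := by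
      ext i
      simp [Φ]
    exact DFunLike.congr_fun this p
  have hdense : Dense (Φ.range : Set C(S2, ℝ)) := by
    have h := ContinuousMap.subalgebra_topologicalClosure_eq_top_of_separatesPoints Φ.range (by
      intro x y hxy
      have : ∃ i, (x : R3) i ≠ (y : R3) i := by
        by_contra! h
        exact hxy (Subtype.ext (PiLp.ext h))
      obtain ⟨i, hi⟩ := this
      exact ⟨Φ (X i), ⟨Φ (X i), ⟨X i, rfl⟩, rfl⟩, by simpa [hΦ] using hi⟩)
    rw [dense_iff_closure_eq, ← Subalgebra.topologicalClosure_coe, h]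
    rfl
  have hL : Dense ((ContinuousMap.toLp 2 surf ℝ) '' (Φ.range : Set C(S2, ℝ))) :=
    (ContinuousMap.toLp_denseRange (p := 2) (E := ℝ) surf ℝ ENNReal.ofNat_ne_top).dense_image
      (ContinuousLinearMap.continuous _) hdense
  refine hL.eq_zero_of_inner_left ℝ ?_
  rintro _ ⟨f, ⟨p, rfl⟩, rfl⟩
  have h := hw p
  rw [polyPair_apply, pair_eq_inner (memLp_of_continuous (continuous_evalR3_coe p))] at h
  rw [real_inner_comm, ← h]
  congr 1
  refine Lp.ext ?_
  filter_upwards [ContinuousMap.coeFn_toLp (p := 2) (𝕜 := ℝ) surf (Φ p),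
    (memLp_of_continuous (continuous_evalR3_coe p)).coeFn_toLp] with x h1 h2
  rw [h2, ← hΦ, ← h1]
  rfl

/-- A square integrable function on the sphere that is orthogonal to all rotation derivatives of
polynomials is constant. -/
theorem ae_const_of_polyPair_angMom {u : L2S} (hu : ∀ j q, polyPair u (angMom j q) = 0) :
    ∃ k : ℝ, ∀ᵐ x ∂surf, u x = k := by
  set k := polyPair u 1 / surf.real univ with hk
  have hc : MemLp (fun _ : S2 => k) 2 surf := memLp_const k
  have h0 : u - hc.toLp _ = 0 := by
    refine eq_zero_of_polyPair_eq_zero fun p => ?_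
    have h1 := polyPair_eq_const_mul_integral hu p
    have hp := memLp_of_continuous (continuous_evalR3_coe p)
    rw [polyPair_apply, pair_eq_inner hp] at h1 ⊢
    rw [inner_sub_right, h1, inner_toLp_eq_integral, integral_mul_const, mul_comm, sub_self]
  refine ⟨k, ?_⟩
  rw [sub_eq_zero] at h0
  rw [h0]
  exact hc.coeFn_toLp

/-- The gradient of a linear form does not depend on the point. -/
lemma pderiv_eq_C_of_isHomogeneous_one {p : MvPolynomial (Fin 3) ℝ} (hp : p.IsHomogeneous 1)
    (i : Fin 3) : pderiv i p = C (polyGrad p 0 i) := by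
  have h : (pderiv i p).IsHomogeneous 0 := hp.pderiv
  have hC := totalDegree_eq_zero_iff_eq_C.mp (Nat.le_zero.mp h.totalDegree_le)
  rw [polyGrad_apply, hC, evalR3_C]

/-- The first order harmonics of the system are three orthogonal linear forms; their brackets
therefore determine all rotation derivatives. -/
theorem polyPair_angMom_eq_zero {Y : Mode → S2 → ℝ} (hY : IsHarmonicSystem Y) {u : L2S}
    (hu : ∀ m, ∀ q : MvPolynomial (Fin 3) ℝ,
      pair (bracket (Y ⟨1, m⟩) fun y : S2 => evalR3 q y) u = 0) (j : Fin 3)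
    (q : MvPolynomial (Fin 3) ℝ) : polyPair u (angMom j q) = 0 := by
  choose p hp hp0 hpe using fun m => hY.harmonic ⟨1, m⟩
  have hpY : ∀ m, Y ⟨1, m⟩ = fun y : S2 => evalR3 (p m) y := fun m => funext (hpe m)
  set v := fun m => polyGrad (p m) 0 with hv
  have hpd : ∀ m i, pderiv i (p m) = C (v m i) := fun m i =>
    pderiv_eq_C_of_isHomogeneous_one (hp m) i
  have hgrad : ∀ m x, polyGrad (p m) x = v m := fun m x => by
    ext i
    rw [polyGrad_apply, hpd, evalR3_C]
  have hv0 : ∀ m, v m ≠ 0 := by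
    intro m h
    refine hY.ne_zero ⟨1, m⟩ ?_
    rw [hpY]
    ext x
    have := inner_self_polyGrad (hp m) x
    rw [hgrad, h, inner_zero_right] at this
    simpa using this.symm
  have hvo : Pairwise fun m m' => inner ℝ (v m) (v m') = 0 := by
    intro m m' hmm
    have ho := hY.orthogonal ⟨1, m⟩ ⟨1, m'⟩ (by simpa using hmm)
    have h1 := integral_polyLaplacian ((hp m).mul (hp m'))
    have h2 : ∀ x : S2, evalR3 (polyLaplacian (p m * p m')) x = 2 * inner ℝ (v m) (v m') := by
      intro x
      have h2 : evalR3 2 (x : R3) = 2 := by simp [evalR3]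
      rw [polyLaplacian_mul, show polyLaplacian (p m) = 0 from hp0 m,
        show polyLaplacian (p m') = 0 from hp0 m', inner_R3]
      simp only [zero_mul, mul_zero, zero_add, Fin.sum_univ_three, evalR3_add, evalR3_mul, h2, hpd,
        evalR3_C]
    have h3 : ∫ x : S2, evalR3 (p m * p m') x ∂surf = 0 := by
      rw [← ho, hpY, hpY]
      simp
    simp_rw [h2] at h1
    rw [h3, mul_zero, integral_const, smul_eq_mul] at h1
    have := surf_univ_pos.ne'
    simpa [this] using h1
  have hli : LinearIndependent ℝ v := linearIndependent_of_ne_zero_of_inner_eq_zero hv0 hvo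
  have hspan : Submodule.span ℝ (range v) = ⊤ := by
    refine hli.span_eq_top_of_card_eq_finrank' ?_
    simp
  set w : R3 := WithLp.toLp 2 fun j => polyPair u (angMom j q) with hw
  have hvw : ∀ m, inner ℝ (v m) w = 0 := by
    intro m
    have h1 := hu m q
    have h2 : bracket (Y ⟨1, m⟩) (fun y : S2 => evalR3 q y) =
        fun x : S2 => evalR3 (polyBracket (p m) q) x := by
      rw [hpY]
      exact funext (bracket_eq_polyBracket (p m) q)
    rw [h2, ← polyPair_apply, polyBracket, map_sum] at h1
    simp only [hpd, ← smul_eq_C_mul, map_smul, smul_eq_mul] at h1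
    rw [PiLp.inner_apply]
    simpa [mul_comm] using h1
  have hw0 : w = 0 := by
    have : w ∈ (Submodule.span ℝ (range v))ᗮ := by
      rw [Submodule.mem_orthogonal]
      intro x hx
      induction hx using Submodule.span_induction with
      | mem x hx => obtain ⟨m, rfl⟩ := hx; exact hvw m
      | zero => exact inner_zero_left _
      | add x y _ _ hx hy => rw [inner_add_left, hx, hy, add_zero]
      | smul c x _ hx => rw [real_inner_smul_left, hx, mul_zero]
    rwa [hspan, Submodule.top_orthogonal_eq_bot, Submodule.mem_bot] at this
  have := congrArg (fun z : R3 => z j) hw0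
  simpa [hw] using this

end Rotations

/-! ### The martingale term -/

lemma continuous_bracket {Y : Mode → S2 → ℝ} (hY : IsHarmonicSystem Y) (i : Mode) {φ : S2 → ℝ}
    (hφ : SmoothOnSphere φ) : Continuous (bracket (Y i) φ) :=
  (continuous_skewGrad_of_harmonic hY i).inner (continuous_sphereGrad hφ)

/-- The modes of degree at most `M`. -/
noncomputable def modesLe (M : ℕ) : Finset Mode :=
  (Finset.range (M + 1)).sigma fun _ => Finset.univ

section NoiseTerm

variable {Ω : Type*} {mΩ : MeasurableSpace Ω} {P : Measure Ω} {𝓕 : Filtration ℝ≥0 mΩ}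

lemma prod_restrict_mono [SFinite P] {t T : ℝ≥0} (h : t ≤ T) :
    (timeMeas.restrict (Iic t)).prod P ≤ (timeMeas.restrict (Iic T)).prod P := by
  have e : timeMeas.restrict (Iic t) = (timeMeas.restrict (Iic T)).restrict (Iic t) := by
    rw [Measure.restrict_restrict measurableSet_Iic, inter_eq_left.mpr (Iic_subset_Iic.mpr h)]
  have h1 := Measure.prod_restrict (μ := timeMeas.restrict (Iic T)) (ν := P) (Iic t) univ
  rw [Measure.restrict_univ] at h1
  rw [e, h1]
  exact Measure.restrict_le_self

namespace IsL2Process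

variable {T t : ℝ≥0} {w : ℝ≥0 → Ω → L2S} {f : S2 → ℝ}

lemma stronglyProgressive_pair (hw : IsL2Process 𝓕 P T w) (hf : MemLp f 2 surf) :
    IsStronglyProgressive 𝓕 fun s θ => pair f (w s θ) := by
  intro r
  simp_rw [pair_eq_inner hf]
  exact (innerSL ℝ (hf.toLp f)).continuous.comp_stronglyMeasurable (hw.prog r)

lemma stronglyMeasurable_pair (hw : IsL2Process 𝓕 P T w) (hf : MemLp f 2 surf) (s : ℝ≥0) :
    StronglyMeasurable fun θ => pair f (w s θ) :=
  ((hw.stronglyProgressive_pair hf).stronglyAdapted s).mono (𝓕.le s)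

lemma memLp_pair [SFinite P] (hw : IsL2Process 𝓕 P T w) (hf : MemLp f 2 surf) (ht : t ≤ T) :
    MemLp (fun z : ℝ≥0 × Ω => pair f (w z.1 z.2)) 2 ((timeMeas.restrict (Iic t)).prod P) := by
  simp_rw [pair_eq_inner hf]
  exact (innerSL ℝ (hf.toLp f)).comp_memLp' (hw.memLp.mono_measure (prod_restrict_mono ht))

lemma integrable_norm_sq (hw : IsL2Process 𝓕 P T w) : Integrable
    (fun z : ℝ≥0 × Ω => ‖w z.1 z.2‖ ^ 2) ((timeMeas.restrict (Iic T)).prod P) :=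
  hw.memLp.norm.integrable_sq

lemma meanEnstrophy_eq [SFinite P] (hw : IsL2Process 𝓕 P T w) : meanEnstrophy P T w =
    ∫ z, ‖w z.1 z.2‖ ^ 2 ∂((timeMeas.restrict (Iic T)).prod P) :=
  (integral_prod_symm _ hw.integrable_norm_sq).symm

end IsL2Process

variable {B : Mode → ℝ≥0 → Ω → ℝ} {Y : Mode → S2 → ℝ} {T t : ℝ≥0} {w : ℝ≥0 → Ω → L2S} {φ : S2 → ℝ}

lemma martingaleTerm_nonneg (ν a : ℝ) (M : ℕ) : 0 ≤ martingaleTerm 𝓕 P B ν a M Y φ w t :=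
  integral_nonneg fun _ => sq_nonneg _

lemma memLp_mul_bracket (hY : IsHarmonicSystem Y) (hφ : SmoothOnSphere φ) (c : ℝ) (i : Mode) :
    MemLp (fun x => c * bracket (Y i) φ x) 2 surf :=
  memLp_of_continuous ((continuous_bracket hY i hφ).const_mul c)

variable [IsProbabilityMeasure P]

/-- The Itô isometry for the martingale term. -/
lemma martingaleTerm_eq (hB : IsBrownianFamily 𝓕 P B) (hY : IsHarmonicSystem Y)
    (hw : IsL2Process 𝓕 P T w) (ht : t ≤ T) (hφ : SmoothOnSphere φ) (ν a : ℝ) (M : ℕ) :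
    martingaleTerm 𝓕 P B ν a M Y φ w t = ∑ i ∈ modesLe M,
      ∫ z, noiseIntegrand ν a M Y φ w i z.1 z.2 ^ 2 ∂((timeMeas.restrict (Iic t)).prod P) := by
  have h := integral_sq_sum_itoIntegral hB (K := noiseIntegrand ν a M Y φ w)
    (fun i => hw.stronglyProgressive_pair (memLp_mul_bracket hY hφ _ i))
    (fun i => hw.memLp_pair (memLp_mul_bracket hY hφ _ i) ht) (modesLe M)
  rw [← h]
  simp only [martingaleTerm, modesLe, sq_abs, Finset.sum_sigma]

/-- The Itô isometry followed by Bessel's inequality at each time. -/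
lemma martingaleTerm_le {ν a : ℝ} (ha : 0 ≤ a) (hB : IsBrownianFamily 𝓕 P B)
    (hY : IsHarmonicSystem Y)
    (hN : (∀ i : Mode, 1 ≤ i.1 → ∫ x, ‖skewGrad (Y i) x‖ ^ 2 ∂surf = 1) ∨
        (1 ≤ a ∧ ∀ i : Mode, 1 ≤ i.1 → ∫ x, Y i x ^ 2 ∂surf = 1))
    (hw : IsL2Process 𝓕 P T w) (ht : t ≤ T) (hφ : SmoothOnSphere φ) (M : ℕ) :
    martingaleTerm 𝓕 P B ν a M Y φ w t ≤
      normSup (noiseAlpha ν a M) ^ 2 * gradSup φ ^ 2 * meanEnstrophy P T w := by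
  set C := normSup (noiseAlpha ν a M) ^ 2 * gradSup φ ^ 2 with hC
  have hi : ∀ i, Integrable (fun z : ℝ≥0 × Ω => noiseIntegrand ν a M Y φ w i z.1 z.2 ^ 2)
      ((timeMeas.restrict (Iic t)).prod P) := fun i =>
    (hw.memLp_pair (memLp_mul_bracket hY hφ _ i) ht).integrable_sq
  have hC0 : 0 ≤ C := by positivity
  rw [martingaleTerm_eq hB hY hw ht hφ, ← integral_finsetSum _ fun i _ => hi i, hw.meanEnstrophy_eq,
    ← integral_const_mul]
  calc ∫ z, ∑ i ∈ modesLe M, noiseIntegrand ν a M Y φ w i z.1 z.2 ^ 2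
        ∂((timeMeas.restrict (Iic t)).prod P)
      ≤ ∫ z, C * ‖w z.1 z.2‖ ^ 2 ∂((timeMeas.restrict (Iic t)).prod P) := by
        refine integral_mono (integrable_finsetSum _ fun i _ => hi i)
          ((hw.integrable_norm_sq.mono_measure (prod_restrict_mono ht)).const_mul C) fun z => ?_
        exact sum_sq_pair_bracket_le hY (noiseAlpha_sq_mul_le ha hY hN M) hφ _ _
    _ ≤ _ := integral_mono_measure (prod_restrict_mono ht)
        (Eventually.of_forall fun z => by positivity) (hw.integrable_norm_sq.const_mul C)

/-- For `a > 1` the coefficients of a fixed mode of positive degree stay away from zero. -/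
lemma exists_tendsto_noiseAlpha {ν a : ℝ} (hν : 0 < ν) (ha : 1 < a) (i : Mode) :
    ∃ c : ℝ, 0 < c ∧ Tendsto (fun M => noiseAlpha ν a M i) atTop (𝓝 c) := by
  have hpos : 0 < √(∑' l : ℕ, (2 * (l : ℝ) + 1) / ((l : ℝ) + 1) ^ (2 * a)) :=
    Real.sqrt_pos.mpr ((summable_coeff ha).tsum_pos (fun l => by positivity) 0 (by simp))
  have h1 : Tendsto (fun M => noiseC a M i) atTop (𝓝 (1 / ((i.1 : ℝ) + 1) ^ a)) := by
    refine tendsto_const_nhds.congr' ?_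
    filter_upwards [eventually_ge_atTop i.1] with M hM
    rw [noiseC, if_pos hM]
  exact ⟨_, by positivity,
    ((tendsto_const_nhds (x := √(2 * ν))).div (tendsto_normTwo_of_one_lt ha) hpos.ne').mul h1⟩

/-- If the martingale terms vanish in the limit although `a > 1`, each bracket of a first order
harmonic with `φ` is orthogonal to the limit process: its pairings with `ω^M` tend to zero in mean
square, and Fatou's lemma passes to the limit. -/
lemma ae_pair_bracket_eq_zero {ν a : ℝ} (hν : 0 < ν) (ha : 1 < a) (hB : IsBrownianFamily 𝓕 P B)
    (hY : IsHarmonicSystem Y) {ω : ℕ → ℝ≥0 → Ω → L2S} (hω : ∀ M, IsL2Process 𝓕 P T (ω M))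
    (ht : t ≤ T) {ω' : ℝ≥0 → Ω → L2S} (hω' : IsL2Process 𝓕 P T ω')
    (hconv : WeakMeanSquareConv P t ω ω') (hφ : SmoothOnSphere φ) (i : Mode)
    (hg : SmoothOnSphere (bracket (Y i) φ))
    (hlim : Tendsto (fun M : ℕ => martingaleTerm 𝓕 P B ν a M Y φ (ω M) t) atTop (𝓝 0)) :
    ∀ᵐ z ∂((timeMeas.restrict (Iic t)).prod P), pair (bracket (Y i) φ) (ω' z.1 z.2) = 0 := by
  set f := bracket (Y i) φ with hf
  have hfm : MemLp f 2 surf := memLp_of_continuous (continuous_bracket hY i hφ)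
  set μ := timeMeas.restrict (Iic t) with hμ
  have hmem : ∀ M, MemLp (fun z : ℝ≥0 × Ω => pair f (ω M z.1 z.2)) 2 (μ.prod P) :=
    fun M => (hω M).memLp_pair hfm ht
  obtain ⟨c, hc, hclim⟩ := exists_tendsto_noiseAlpha hν ha i
  -- the mode `i` alone is dominated by the martingale term
  have h1 : Tendsto (fun M => ∫ z, pair f (ω M z.1 z.2) ^ 2 ∂(μ.prod P)) atTop (𝓝 0) := by
    have h2 : Tendsto (fun M => noiseAlpha ν a M i ^ 2 * ∫ z, pair f (ω M z.1 z.2) ^ 2 ∂(μ.prod P))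
        atTop (𝓝 0) := by
      refine squeeze_zero' (Eventually.of_forall fun M => ?_) ?_ hlim
      · exact mul_nonneg (sq_nonneg _) (integral_nonneg fun z => sq_nonneg _)
      · filter_upwards [eventually_ge_atTop i.1] with M hM
        rw [martingaleTerm_eq hB hY (hω M) ht hφ]
        have hiM : i ∈ modesLe M := by simp [modesLe, hM]
        refine le_trans (le_of_eq ?_) (Finset.single_le_sum
          (f := fun i => ∫ z, noiseIntegrand ν a M Y φ (ω M) i z.1 z.2 ^ 2 ∂(μ.prod P))
          (fun j _ => integral_nonneg fun z => sq_nonneg _) hiM)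
        rw [← integral_const_mul]
        refine integral_congr_ae (Eventually.of_forall fun z => ?_)
        simp only [noiseIntegrand, pair, ← mul_pow, mul_assoc, integral_const_mul]
        rfl
    have h3 := h2.div (hclim.pow 2) (by positivity)
    rw [zero_div] at h3
    refine h3.congr' ?_
    filter_upwards [hclim.eventually (lt_mem_nhds hc)] with M hM
    rw [Pi.div_apply, mul_div_cancel_left₀ _ (pow_ne_zero 2 hM.ne')]
  have h1' : Tendsto (fun M => ∫⁻ s, ∫⁻ θ, ‖pair f (ω M s θ)‖ₑ ^ 2 ∂P ∂μ) atTop (𝓝 0) := by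
    have h2 := ENNReal.tendsto_ofReal h1
    rw [ENNReal.ofReal_zero] at h2
    refine h2.congr fun M => ?_
    rw [ofReal_integral_eq_lintegral_ofReal (hmem M).integrable_sq
      (Eventually.of_forall fun z => sq_nonneg _)]
    rw [← lintegral_prod (fun z : ℝ≥0 × Ω => ‖pair f (ω M z.1 z.2)‖ₑ ^ 2)
      ((hmem M).aestronglyMeasurable.enorm.pow_const 2)]
    refine lintegral_congr fun z => ?_
    rw [← ofReal_norm, ← ENNReal.ofReal_pow (norm_nonneg _), Real.norm_eq_abs, sq_abs]
  have hmem' : MemLp (fun z : ℝ≥0 × Ω => pair f (ω' z.1 z.2)) 2 (μ.prod P) :=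
    hω'.memLp_pair hfm ht
  have hle : ∀ᵐ s ∂μ, ∫⁻ θ, ‖pair f (ω' s θ)‖ₑ ^ 2 ∂P ≤
      liminf (fun M => 2 * ∫⁻ θ, ‖pair f (ω M s θ)‖ₑ ^ 2 ∂P) atTop := by
    filter_upwards [hconv f hg] with s hs
    have hs2 : Tendsto (fun M => 2 * ∫⁻ θ, ‖pair f (ω M s θ - ω' s θ)‖ₑ ^ 2 ∂P) atTop (𝓝 0) := by
      simpa using ENNReal.Tendsto.const_mul hs (Or.inr ENNReal.ofNat_ne_top) (a := 2)
    rw [← ENNReal.liminf_add_of_right_tendsto_zero hs2]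
    refine le_liminf_of_le (by isBoundedDefault) (Eventually.of_forall fun M => ?_)
    rw [Pi.add_apply, ← lintegral_const_mul' _ _ ENNReal.ofNat_ne_top,
      ← lintegral_const_mul' _ _ ENNReal.ofNat_ne_top,
      ← lintegral_add_left (((hω M).stronglyMeasurable_pair hfm s).enorm.pow_const 2 |>.const_mul 2)]
    refine lintegral_mono fun θ => ?_
    have e : pair f (ω' s θ) = pair f (ω M s θ) - pair f (ω M s θ - ω' s θ) := by
      simp only [pair_eq_inner hfm, inner_sub_right]
      ring
    rw [e, ← mul_add]
    calc ‖pair f (ω M s θ) - pair f (ω M s θ - ω' s θ)‖ₑ ^ 2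
        ≤ (‖pair f (ω M s θ)‖ₑ + ‖pair f (ω M s θ - ω' s θ)‖ₑ) ^ 2 := by
          gcongr
          exact enorm_sub_le
      _ ≤ _ := by
          simp only [enorm_eq_nnnorm]
          norm_cast
          exact add_sq_le
  have h0 : ∫⁻ z, ‖pair f (ω' z.1 z.2)‖ₑ ^ 2 ∂(μ.prod P) = 0 := by
    rw [lintegral_prod _ (hmem'.aestronglyMeasurable.enorm.pow_const 2)]
    refine le_antisymm ((lintegral_mono_ae hle).trans ?_) zero_le
    refine (lintegral_liminf_le' fun M => ?_).trans (le_of_eq ?_)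
    · exact (((hmem M).aestronglyMeasurable.enorm.pow_const 2).lintegral_prod_right').const_mul 2
    · simp_rw [lintegral_const_mul' _ _ ENNReal.ofNat_ne_top]
      refine Tendsto.liminf_eq ?_
      simpa using ENNReal.Tendsto.const_mul h1' (Or.inr ENNReal.ofNat_ne_top) (a := 2)
  rw [lintegral_eq_zero_iff' (hmem'.aestronglyMeasurable.enorm.pow_const 2)] at h0
  filter_upwards [h0] with z hz
  simpa using hz

lemma polyBracket_add (p q q' : MvPolynomial (Fin 3) ℝ) :
    polyBracket p (q + q') = polyBracket p q + polyBracket p q' := by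
  simp only [polyBracket, angMom, map_add, ← Finset.sum_add_distrib]
  exact Finset.sum_congr rfl fun j _ => by ring

lemma polyBracket_smul (c : ℝ) (p q : MvPolynomial (Fin 3) ℝ) :
    polyBracket p (c • q) = c • polyBracket p q := by
  simp only [polyBracket, angMom, Derivation.map_smul, Finset.smul_sum]
  simp only [MvPolynomial.smul_eq_C_mul]
  exact Finset.sum_congr rfl fun j _ => by ring

/-- If `a > 1` and all martingale terms vanish in the limit, the limit process is annihilated by all
rotations, hence constant in space. -/
lemma le_one_of_tendsto_martingaleTerm {ν a : ℝ} (hν : 0 < ν) (hB : IsBrownianFamily 𝓕 P B)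
    (hY : IsHarmonicSystem Y) {ω : ℕ → ℝ≥0 → Ω → L2S} (hω : ∀ M, IsL2Process 𝓕 P T (ω M))
    (ht : t ≤ T) {ω' : ℝ≥0 → Ω → L2S} (hω' : IsL2Process 𝓕 P T ω')
    (hconv : WeakMeanSquareConv P t ω ω') (hns : ¬ SpatiallyConstant P t ω')
    (hlim : ∀ φ : S2 → ℝ, SmoothOnSphere φ →
      Tendsto (fun M : ℕ => martingaleTerm 𝓕 P B ν a M Y φ (ω M) t) atTop (𝓝 0)) : a ≤ 1 := by
  by_contra! ha
  refine hns ?_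
  have hpoly : ∀ i, ∃ p : MvPolynomial (Fin 3) ℝ, Y i = fun y : S2 => evalR3 p y := fun i => by
    obtain ⟨p, _, _, h⟩ := hY.harmonic i
    exact ⟨p, funext h⟩
  choose p hp using hpoly
  have hbr : ∀ i (q : MvPolynomial (Fin 3) ℝ), bracket (Y i) (fun y : S2 => evalR3 q y) =
      fun y : S2 => evalR3 (polyBracket (p i) q) y := fun i q => by
    rw [hp]
    exact funext (bracket_eq_polyBracket (p i) q)
  -- countably many test functions suffice: the monomials
  have hae : ∀ᵐ z ∂((timeMeas.restrict (Iic t)).prod P), ∀ m, ∀ d : Fin 3 →₀ ℕ,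
      pair (bracket (Y ⟨1, m⟩) fun y : S2 => evalR3 (MvPolynomial.monomial d 1) y)
        (ω' z.1 z.2) = 0 := by
    rw [ae_all_iff]
    intro m
    rw [ae_all_iff]
    intro d
    refine ae_pair_bracket_eq_zero hν ha hB hY hω ht hω' hconv (smoothOnSphere_evalR3 _) ⟨1, m⟩ ?_
      (hlim _ (smoothOnSphere_evalR3 _))
    rw [hbr]
    exact smoothOnSphere_evalR3 _
  filter_upwards [hae] with z hz
  refine ae_const_of_polyPair_angMom (polyPair_angMom_eq_zero hY fun m q => ?_)
  rw [hbr, ← polyPair_apply]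
  induction q using MvPolynomial.induction_on' with
  | monomial d c =>
    have h1 := hz m d
    rw [hbr, ← polyPair_apply] at h1
    rw [← mul_one c, ← smul_eq_mul, ← MvPolynomial.smul_monomial, polyBracket_smul, map_smul, h1,
      smul_zero]
  | add q q' hq hq' => rw [polyBracket_add, map_add, hq, hq', add_zero]

end NoiseTerm

theorem mainTheorem3 (ν a : ℝ) (hν : 0 < ν) (ha : 0 ≤ a) :
    -- the norms of the coefficients
    (∀ M : ℕ, normTwo (noiseAlpha ν a M) ^ 2 = 2 * ν ∧
      normSup (noiseAlpha ν a M) = √(2 * ν) * (normTwo (noiseC a M))⁻¹) ∧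
    -- the asymptotics of the `ℓ²` norm of `c^M`
    (a < 1 → Asymptotics.IsEquivalent atTop (fun M : ℕ => normTwo (noiseC a M))
      (fun M : ℕ => ((M : ℝ) + 1) ^ (1 - a) / √(1 - a))) ∧
    (a = 1 → Asymptotics.IsEquivalent atTop (fun M : ℕ => normTwo (noiseC a M))
      (fun M : ℕ => √(2 * Real.log ((M : ℝ) + 1)))) ∧
    (1 < a → Summable (fun l : ℕ => (2 * (l : ℝ) + 1) / ((l : ℝ) + 1) ^ (2 * a)) ∧
      Tendsto (fun M : ℕ => normTwo (noiseC a M)) atTop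
        (𝓝 (√(∑' l : ℕ, (2 * (l : ℝ) + 1) / ((l : ℝ) + 1) ^ (2 * a))))) ∧
    -- the `ℓ^∞` norm tends to zero exactly for `a ≤ 1`
    (Tendsto (fun M : ℕ => normSup (noiseAlpha ν a M)) atTop (𝓝 0) ↔ a ≤ 1) ∧
    -- the martingale term
    (∀ {Ω : Type*} {mΩ : MeasurableSpace Ω} (P : Measure Ω) [IsProbabilityMeasure P]
      (𝓕 : Filtration ℝ≥0 mΩ) (B : Mode → ℝ≥0 → Ω → ℝ), IsBrownianFamily 𝓕 P B →
      ∀ Y : Mode → S2 → ℝ, IsHarmonicSystem Y →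
      ((∀ i : Mode, 1 ≤ i.1 → ∫ x, ‖skewGrad (Y i) x‖ ^ 2 ∂surf = 1) ∨
        (1 ≤ a ∧ ∀ i : Mode, 1 ≤ i.1 → ∫ x, Y i x ^ 2 ∂surf = 1)) →
      ∀ (T : ℝ≥0) (ω : ℕ → ℝ≥0 → Ω → L2S), (∀ M, IsL2Process 𝓕 P T (ω M)) →
      ∀ t : ℝ≥0, t ≤ T →
        -- the stochastic integrals exist, and the martingale term is bounded
        (∀ φ : S2 → ℝ, SmoothOnSphere φ → ∀ M : ℕ,
          (∀ i : Mode, ∃ I : Ω → ℝ,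
            IsItoIntegral 𝓕 P (B i) (noiseIntegrand ν a M Y φ (ω M) i) t I) ∧
          martingaleTerm 𝓕 P B ν a M Y φ (ω M) t ≤
            normSup (noiseAlpha ν a M) ^ 2 * gradSup φ ^ 2 * meanEnstrophy P T (ω M)) ∧
        -- it vanishes in the limit if `a ≤ 1`
        (a ≤ 1 → (∃ K : ℝ, ∀ M, meanEnstrophy P T (ω M) ≤ K) →
          ∀ φ : S2 → ℝ, SmoothOnSphere φ →
            Tendsto (fun M : ℕ => martingaleTerm 𝓕 P B ν a M Y φ (ω M) t) atTop (𝓝 0)) ∧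
        -- it can vanish in the limit only if `a ≤ 1`
        (∀ ω' : ℝ≥0 → Ω → L2S, IsL2Process 𝓕 P T ω' → WeakMeanSquareConv P t ω ω' →
          ¬ SpatiallyConstant P t ω' →
          (∀ φ : S2 → ℝ, SmoothOnSphere φ →
            Tendsto (fun M : ℕ => martingaleTerm 𝓕 P B ν a M Y φ (ω M) t) atTop (𝓝 0)) →
          a ≤ 1)) := by
  refine ⟨fun M => ⟨normTwo_noiseAlpha_sq hν a M, normSup_noiseAlpha ν ha M⟩,
    isEquivalent_normTwo_of_lt_one, ?_,
    fun h => ⟨summable_coeff h, tendsto_normTwo_of_one_lt h⟩,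
    tendsto_normSup_noiseAlpha_iff hν ha, ?_⟩
  · rintro rfl
    exact isEquivalent_normTwo_one
  intro Ω mΩ P _ 𝓕 B hB Y hY hN T ω hω t ht
  refine ⟨fun φ hφ M => ⟨fun i => ?_, martingaleTerm_le ha hB hY hN (hω M) ht hφ M⟩, ?_,
    fun ω' hω' hconv hns hlim =>
      le_one_of_tendsto_martingaleTerm hν hB hY hω ht hω' hconv hns hlim⟩
  · exact exists_isItoIntegral hB i
      ((hω M).stronglyProgressive_pair (memLp_mul_bracket hY hφ _ i))
      ((hω M).memLp_pair (memLp_mul_bracket hY hφ _ i) ht)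
  · rintro h ⟨K, hK⟩ φ hφ
    have hα : Tendsto (fun M => normSup (noiseAlpha ν a M) ^ 2 * gradSup φ ^ 2 * K) atTop (𝓝 0) := by
      simpa using ((((tendsto_normSup_noiseAlpha_iff hν ha).mpr h).pow 2).mul_const
        (gradSup φ ^ 2)).mul_const K
    exact squeeze_zero (fun M => martingaleTerm_nonneg ν a M)
      (fun M => (martingaleTerm_le ha hB hY hN (hω M) ht hφ M).trans
        (mul_le_mul_of_nonneg_left (hK M) (by positivity))) hα
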